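/- Let $S=(V,T)$ be a triangulated surface in $\mathbb R^3$: a finite set $V\subset\mathbb R^3$ of vertices and a finite set $T$ of nondegenerate triangles with vertices in $V$, each vertex belonging to at least one triangle (the edges are the sides of the triangles). Let $V_f$ be the set of vertices of the triangle $f$, $T_v$ the set of triangles containing $v$, $|f|$ the area of $f$, and $|v|=\frac13\sum_{f\in T_v}|f|$. Let $\mathcal P(S)=\{\mu\in\mathbb R^{V}:\mu_v\ge 0 \text{ for all } v,\ \sum_{v}|v|\mu_v=1\}$, and write $\hat\mu_f=\frac13\sum_{v\in V_f}\mu_v$. For $\varphi\in\mathbb R^V$ let $(G\varphi)_f\in\mathbb R^3$ be the gradient, in the plane of $f$, of the affine function on $f$ that coincides with $\varphi$ at the vertices of $f$; $G$ also denotes the corresponding $3|T|\times|V|$ matrix. Let $M_V,M_T,M_{\hat\mu}$ be the diagonal matrices of multiplication by $|v|$ at each vertex, by $|f|$ on each triangle, and by $\hat\mu_f$ on each triangle, respectively. For $\bar\mu^0,\bar\mu^1\in\mathcal P(S)$ define $$W_d^2(\bar\mu^0,\bar\mu^1)=\sup_\varphi\Big\{\sum_{v}|v|\varphi^1_v\bar\mu^1_v-\sum_v|v|\varphi^0_v\bar\mu^0_v\Big\}\in[0,\infty],$$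 the supremum being over all $\varphi:[0,1]\times V\to\mathbb R$, differentiable in time, with $$\partial_t\varphi^t_v+\frac12\,\frac{\sum_{f\in T_v}|f|\,\|(G\varphi^t)_f\|^2}{3|v|}\le 0\quad\text{for all }(t,v)\in[0,1]\times V.$$ Call $(\mu,\mathbf v)$ admissible if $\mu:[0,1]\to\mathcal P(S)$ is an absolutely continuous curve with $\mu^0=\bar\mu^0$, $\mu^1=\bar\mu^1$, if $\mathbf v^t_f\in\mathbb R^3$ is parallel to the plane of $f$ for all $t\in[0,1]$ and $f\in T$ and is measurable in $t$, and if $\partial_t(M_V\mu^t)_v-\big(G^\top M_T[\hat\mu^t\mathbf v^t]\big)_v=0$ for all $v\in V$ and almost every $t\in[0,1]$. Then $$W_d^2(\bar\mu^0,\bar\mu^1)=\min_{(\mu,\mathbf v)\ \text{admissible}}\ \int_0^1\sum_{f\in T}\tfrac12\|\mathbf v^t_f\|^2|f|\hat\mu^t_f\,dt .$$ More precisely, the identity holds with an infimum in $[0,\infty]$ (with $\inf\emptyset=+\infty$), and the infimum is attained as soon as an admissible pair exists. If $S$ is connected, an admissible pair exists and $W_d^2(\bar\mu^0,\bar\mu^1)<\infty$.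 Moreover, if $\bar\mu^0_v>0$ and $\bar\mu^1_v>0$ for all $v$, then $W_d$ is given by the minimization of the Riemannian energy: $$W_d^2(\bar\mu^0,\bar\mu^1)=\inf_\mu\int_0^1\|\partial_t\mu^t\|^2_{T_{\mu^t}\mathcal P(S)}\,dt,$$ the infimum being over all absolutely continuous curves $\mu:[0,1]\to\mathcal P(S)$ from $\bar\mu^0$ to $\bar\mu^1$ with $\mu^t_v>0$ for all $t,v$. Here, for positive $\mu$, $\|\delta\mu\|^2_{T_\mu\mathcal P(S)}=\frac12\sum_{f}\|(G\varphi)_f\|^2|f|\hat\mu_f$ for any solution $\varphi\in\mathbb R^V$ of $M_V\,\delta\mu=-(G^\top M_TM_{\hat\mu}G)\varphi$ (the value does not depend on the solution), and it is $+\infty$ if there is no solution, which does not happen if $S$ is connected and $\sum_v|v|\,\delta\mu_v=0$. -/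

import Mathlib

open MeasureTheory Set
open scoped Matrix ENNReal

noncomputable section

/-- A triangulated surface in `ℝ³`: a finite set `V` of vertices and a finite set `T` of
nondegenerate triangles, given as triples of vertices, each triangle being listed once and each
vertex belonging to some triangle. The edges are the pairs of distinct vertices of a common
triangle, see `TriSurface.edgeGraph`. Boundary and arbitrary topology are allowed. -/
structure TriSurface where
  /-- the vertices -/
  V : Finset (EuclideanSpace ℝ (Fin 3))
  /-- the triangles -/
  T : Finset (Fin 3 → V)
  nondegenerate : ∀ f ∈ T, AffineIndependent ℝ (fun i => (f i : EuclideanSpace ℝ (Fin 3)))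
  listed_once : ∀ f ∈ T, ∀ g ∈ T, Set.range f = Set.range g → f = g
  vertex_mem : ∀ v : V, ∃ f ∈ T, v ∈ Set.range f

namespace TriSurface

variable (S : TriSurface)

/-- The graph of the edges of the surface. -/
def edgeGraph : SimpleGraph S.V where
  Adj u w := u ≠ w ∧ ∃ f ∈ S.T, u ∈ Set.range f ∧ w ∈ Set.range f
  symm := ⟨fun _ _ h => ⟨h.1.symm, h.2.imp fun _ hf => ⟨hf.1, hf.2.2, hf.2.1⟩⟩⟩
  loopless := ⟨fun _ h => h.1 rfl⟩

/-- The surface is connected. -/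
def Connected : Prop := S.edgeGraph.Connected

open Classical in
/-- `V_f`: the set of vertices of the triangle `f`. -/
def vertsOf (f : S.T) : Finset S.V := Finset.univ.image f.1

open Classical in
/-- `T_v`: the set of triangles that contain the vertex `v`. -/
def facesAt (v : S.V) : Finset S.T := Finset.univ.filter fun f => v ∈ S.vertsOf f

/-- The position in `ℝ³` of the `i`-th vertex of the triangle `f`. -/
def corner (f : S.T) (i : Fin 3) : EuclideanSpace ℝ (Fin 3) := (f.1 i).1

/-- `|f|`: the area of the triangle `f` (half of the area of the parallelogram spanned by two
sides, through the Gram determinant). -/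
def area (f : S.T) : ℝ :=
  (1 / 2) * Real.sqrt
    (‖S.corner f 1 - S.corner f 0‖ ^ 2 * ‖S.corner f 2 - S.corner f 0‖ ^ 2
      - (inner ℝ (S.corner f 1 - S.corner f 0) (S.corner f 2 - S.corner f 0)) ^ 2)

/-- `|v|`: the area of the barycentric dual cell of the vertex `v`. -/
def dualArea (v : S.V) : ℝ := (1 / 3) * ∑ f ∈ S.facesAt v, S.area f

/-- `P(S)`: the probability distributions on the surface, given by their density at the
vertices. -/
def Prob : Set (S.V → ℝ) :=
  {μ | (∀ v, 0 ≤ μ v) ∧ ∑ v, S.dualArea v * μ v = 1}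

/-- `μ̂_f`: the density averaged over the vertices of the triangle `f`. -/
def avg (μ : S.V → ℝ) (f : S.T) : ℝ := (1 / 3) * ∑ v ∈ S.vertsOf f, μ v

/-- The directions parallel to the plane of the triangle `f`. -/
def tangent (f : S.T) : Submodule ℝ (EuclideanSpace ℝ (Fin 3)) :=
  vectorSpan ℝ (Set.range (S.corner f))

theorem existsUnique_grad (φ : S.V → ℝ) (f : S.T) :
    ∃! g : EuclideanSpace ℝ (Fin 3), g ∈ S.tangent f ∧
      ∀ i j, inner ℝ g (S.corner f i - S.corner f j) = φ (f.1 i) - φ (f.1 j) := by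
  have hind : AffineIndependent ℝ (S.corner f) := S.nondegenerate f.1 f.2
  have hspan : S.tangent f =
      Submodule.span ℝ (Set.range fun i : Fin 2 => S.corner f i.succ - S.corner f 0) := by
    rw [tangent, vectorSpan_range_eq_span_range_vsub_right ℝ _ (0 : Fin 3)]
    apply le_antisymm
    · rw [Submodule.span_le]
      rintro _ ⟨i, rfl⟩
      refine Fin.cases ?_ (fun i => ?_) i
      · simp
      · exact Submodule.subset_span ⟨i, rfl⟩
    · rw [Submodule.span_le]
      rintro _ ⟨i, rfl⟩
      exact Submodule.subset_span ⟨i.succ, rfl⟩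
  have hrank : Module.finrank ℝ (S.tangent f) = 2 :=
    hind.finrank_vectorSpan (by simp)
  let L : S.tangent f →ₗ[ℝ] (Fin 2 → ℝ) :=
    LinearMap.pi fun i =>
      (innerₗ (EuclideanSpace ℝ (Fin 3)) (S.corner f i.succ - S.corner f 0)) ∘ₗ
        (S.tangent f).subtype
  have hL : ∀ g i, L g i = inner ℝ (g : EuclideanSpace ℝ (Fin 3))
      (S.corner f i.succ - S.corner f 0) := fun g i => by
    rw [real_inner_comm]; rfl
  have hinj : Function.Injective L := by
    rw [injective_iff_map_eq_zero]
    rintro ⟨g, hg⟩ h0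
    have h1 : ∀ i : Fin 2, inner ℝ g (S.corner f i.succ - S.corner f 0) = 0 := fun i => by
      have := congrFun h0 i
      rwa [hL] at this
    have h2 : S.tangent f ≤ (ℝ ∙ g)ᗮ := by
      rw [hspan, Submodule.span_le]
      rintro _ ⟨i, rfl⟩
      exact Submodule.mem_orthogonal_singleton_iff_inner_right.2 (h1 i)
    have h3 := Submodule.mem_orthogonal_singleton_iff_inner_right.1 (h2 hg)
    exact Subtype.ext (inner_self_eq_zero.1 h3)
  have hsurj : Function.Surjective L :=
    (LinearMap.injective_iff_surjective_of_finrank_eq_finrank (by simp [hrank])).1 hinj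
  obtain ⟨g, hg⟩ := hsurj fun i => φ (f.1 i.succ) - φ (f.1 0)
  have key : ∀ i, inner ℝ (g : EuclideanSpace ℝ (Fin 3)) (S.corner f i - S.corner f 0)
      = φ (f.1 i) - φ (f.1 0) := by
    refine Fin.cases (by simp) fun i => ?_
    rw [← hL, hg]
  refine ⟨g, ⟨g.2, fun i j => ?_⟩, ?_⟩
  · have h : S.corner f i - S.corner f j
        = (S.corner f i - S.corner f 0) - (S.corner f j - S.corner f 0) := by abel
    rw [h, inner_sub_right, key, key]; ring
  · rintro g' ⟨hg', h'⟩
    have : (⟨g', hg'⟩ : S.tangent f) = g := by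
      apply hinj
      funext i
      rw [hL, hL, h', key]
    exact congrArg Subtype.val this

/-- `(Gφ)_f`: the gradient, in the plane of the triangle `f`, of the affine function on `f` that
takes the values of `φ` at the three vertices. -/
def gradAt (φ : S.V → ℝ) (f : S.T) : EuclideanSpace ℝ (Fin 3) :=
  (S.existsUnique_grad φ f).choose

theorem gradAt_spec (φ : S.V → ℝ) (f : S.T) : S.gradAt φ f ∈ S.tangent f ∧
    ∀ i j, inner ℝ (S.gradAt φ f) (S.corner f i - S.corner f j) = φ (f.1 i) - φ (f.1 j) :=
  (S.existsUnique_grad φ f).choose_spec.1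

theorem gradAt_eq {φ : S.V → ℝ} {f : S.T} {g : EuclideanSpace ℝ (Fin 3)}
    (hg : g ∈ S.tangent f)
    (h : ∀ i j, inner ℝ g (S.corner f i - S.corner f j) = φ (f.1 i) - φ (f.1 j)) :
    S.gradAt φ f = g :=
  ((S.existsUnique_grad φ f).choose_spec.2 g ⟨hg, h⟩).symm

/-- The gradient as a linear map. -/
def gradLin : (S.V → ℝ) →ₗ[ℝ] (S.T → EuclideanSpace ℝ (Fin 3)) where
  toFun φ f := S.gradAt φ f
  map_add' φ ψ := by
    funext f
    refine S.gradAt_eq (add_mem (S.gradAt_spec φ f).1 (S.gradAt_spec ψ f).1) fun i j => ?_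
    simp only [inner_add_left, (S.gradAt_spec φ f).2, (S.gradAt_spec ψ f).2, Pi.add_apply]
    ring
  map_smul' c φ := by
    funext f
    refine S.gradAt_eq (Submodule.smul_mem _ c (S.gradAt_spec φ f).1) fun i j => ?_
    simp only [inner_smul_left, (S.gradAt_spec φ f).2, Pi.smul_apply, smul_eq_mul,
      RingHom.id_apply]
    simp only [conj_trivial]
    ring

open Classical in
/-- The matrix `G` of the gradient, of size `3|T| × |V|`. -/
def G : Matrix (S.T × Fin 3) S.V ℝ :=
  Matrix.of fun p v => S.gradAt (Pi.single v 1) p.1 p.2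

theorem G_mulVec (φ : S.V → ℝ) (f : S.T) (k : Fin 3) :
    (S.G *ᵥ φ) (f, k) = S.gradAt φ f k := by
  classical
  have h : S.gradLin φ = ∑ v, φ v • S.gradLin (Pi.single v 1) := by
    conv_lhs => rw [pi_eq_sum_univ' φ]
    simp only [map_sum, map_smul]
  have h2 : S.gradAt φ f = ∑ v, φ v • S.gradAt (Pi.single v 1) f := by
    have := congrFun h f
    simpa [gradLin] using this
  rw [h2]
  simp only [Matrix.mulVec, dotProduct, G, Matrix.of_apply, WithLp.ofLp_sum, WithLp.ofLp_smul,
    Finset.sum_apply, Pi.smul_apply, smul_eq_mul]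
  exact Finset.sum_congr rfl fun v _ => by rw [mul_comm]

open Classical in
/-- The diagonal matrix `M_V` of the areas of the dual cells. -/
def MV : Matrix S.V S.V ℝ := Matrix.diagonal S.dualArea

open Classical in
/-- The diagonal matrix `M_T` of the areas of the triangles. -/
def MT : Matrix (S.T × Fin 3) (S.T × Fin 3) ℝ := Matrix.diagonal fun p => S.area p.1

open Classical in
/-- The diagonal matrix of the multiplication, on each triangle, by the averaged density. -/
def Mavg (μ : S.V → ℝ) : Matrix (S.T × Fin 3) (S.T × Fin 3) ℝ :=
  Matrix.diagonal fun p => S.avg μ p.1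

/-- A potential `φ : [0,1] × V → ℝ` is admissible if it is differentiable in time and satisfies the
discrete Hamilton-Jacobi inequality at all times and vertices. -/
def IsSubsolution (φ : ℝ → S.V → ℝ) : Prop :=
  (∀ v, DifferentiableOn ℝ (fun t => φ t v) (Icc 0 1)) ∧
  ∀ t ∈ Icc (0 : ℝ) 1, ∀ v,
    derivWithin (fun s => φ s v) (Icc 0 1) t
      + (1 / 2) * ((∑ f ∈ S.facesAt v, S.area f * ‖S.gradAt (φ t) f‖ ^ 2)
          / (3 * S.dualArea v)) ≤ 0

/-- `W_d²`, with values in `[-∞, ∞]`. -/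
def wassersteinSq (μ₀ μ₁ : S.V → ℝ) : EReal :=
  ⨆ (φ : ℝ → S.V → ℝ) (_ : S.IsSubsolution φ),
    ((∑ v, S.dualArea v * φ 1 v * μ₁ v - ∑ v, S.dualArea v * φ 0 v * μ₀ v : ℝ) : EReal)

/-- The absolutely continuous curves `[0,1] → P(S)` from `μ₀` to `μ₁`. -/
structure IsCurve (μ₀ μ₁ : S.V → ℝ) (μ : ℝ → S.V → ℝ) : Prop where
  mem_prob : ∀ t ∈ Icc (0 : ℝ) 1, μ t ∈ S.Prob
  start : μ 0 = μ₀
  finish : μ 1 = μ₁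
  absCont : ∀ v, AbsolutelyContinuousOnInterval (fun t => μ t v) 0 1

/-- Admissible pairs of a curve of densities and a tangent velocity field, one vector per triangle,
for the discrete continuity equation. -/
structure IsAdmissible (μ₀ μ₁ : S.V → ℝ) (μ : ℝ → S.V → ℝ)
    (w : ℝ → S.T → EuclideanSpace ℝ (Fin 3)) : Prop where
  isCurve : S.IsCurve μ₀ μ₁ μ
  tangent : ∀ t ∈ Icc (0 : ℝ) 1, ∀ f, w t f ∈ S.tangent f
  measurable : ∀ f, AEMeasurable (fun t => w t f) (volume.restrict (Icc (0 : ℝ) 1))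
  /-- the equation `∂ₜ (M_V μ) = Gᵀ M_T [μ̂ w]` -/
  continuity : ∀ᵐ t ∂(volume.restrict (Icc (0 : ℝ) 1)), ∀ v,
    HasDerivAt (fun s => (S.MV *ᵥ μ s) v)
      (((S.Gᵀ * S.MT) *ᵥ fun p => S.avg (μ t) p.1 * w t p.1 p.2) v) t

/-- The action of a curve with a velocity field. -/
def action (μ : ℝ → S.V → ℝ) (w : ℝ → S.T → EuclideanSpace ℝ (Fin 3)) : ℝ≥0∞ :=
  ∫⁻ t in Icc (0 : ℝ) 1,
    ENNReal.ofReal (∑ f, (1 / 2) * ‖w t f‖ ^ 2 * S.area f * S.avg (μ t) f)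

/-- The squared norm of a variation `δ` in the tangent space at `μ`: the value of
`½ ∑_f ‖(Gφ)_f‖² |f| μ̂_f` at any solution `φ` of `M_V δ = -(Gᵀ M_T M_μ̂ G) φ`. If `μ` is positive,
the value does not depend on the solution. It is `∞` if there is no solution. -/
def tangentNormSq (μ δ : S.V → ℝ) : ℝ≥0∞ :=
  ⨅ (φ : S.V → ℝ) (_ : S.MV *ᵥ δ = -((S.Gᵀ * S.MT * S.Mavg μ * S.G) *ᵥ φ)),
    ENNReal.ofReal ((1 / 2) * ∑ f, ‖S.gradAt φ f‖ ^ 2 * S.area f * S.avg μ f)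

/-- The Riemannian energy of a curve of densities. -/
def energy (μ : ℝ → S.V → ℝ) : ℝ≥0∞ :=
  ∫⁻ t in Icc (0 : ℝ) 1, S.tangentNormSq (μ t) fun v => deriv (fun s => μ s v) t

end TriSurface

end

/-!
The Wasserstein distance is defined as the supremum of a concave dual problem over subsolutions of
the discrete Hamilton-Jacobi inequality; the theorem is strong duality with the dynamic
(Benamou-Brenier) problem, and the density of positive curves in the latter.

*Weak duality* (`TriSurface.wassersteinSq_le_lintegral`). Along an absolutely continuous curve `μ`,
the derivative of `⟨φ, M_V μ⟩` is at most `⟨φ, M_V ∂ₜμ⟩ - ½ ⟨Gφ, M_T M_μ̂ Gφ⟩`, because the average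
over the triangles around a vertex is adjoint to the average over the vertices of a triangle. If
`(μ, w)` solves the continuity equation, then the right-hand side is at most the action density, by
Young's inequality, and it is always at most the squared tangent norm. Potentials are only
differentiable in time, but they are monotone, hence absolutely continuous.

*Strong duality* (`TriSurface.exists_isAdmissible_action_le`). The Lagrangian
`D(φ) - ∫ (⟨∂ₜφ, M_V μ⟩ + ½ ⟨Gφ, M_T M_μ̂ Gφ⟩) dt`, where `D(φ) = ⟨φ¹, M_V μ¹⟩ - ⟨φ⁰, M_V μ⁰⟩`, is
affine in `μ` and concave in `φ`, and the set of measurable families of densities is weakly compact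
in `L²(0, 1)`. For fixed `φ`, the minimum of the Lagrangian over `μ` is the dual value of the
subsolution obtained from `φ` by subtracting the time integral of the spatial maximum of the
Hamilton-Jacobi expression. So Sion's minimax theorem produces one `μ` such that
`D(φ) - ∫ ⟨∂ₜφ, M_V μ⟩ - ½ ∫ ⟨Gφ, M_T M_μ̂ Gφ⟩ ≤ W` for all smooth `φ`, where `W` is the supremum.
The part that is linear in `φ` is then bounded in the norm of `√(|f| μ̂_f) Gφ`, and its Riesz
representative, divided by `√(|f| μ̂_f)`, is a velocity of action at most `W` that solves the
continuity equation weakly. By du Bois-Reymond, `μ` is a primitive, which gives the absolutely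
continuous version with the right ends.

*Finiteness* (`TriSurface.wassersteinSq_lt_top_of_connected`). On a connected surface the kernel of
the gradient consists of the constants, so the difference of two densities is a divergence, and a
curve that mixes in the uniform density, quadratically in time near its ends, has finite action.

*Positive curves* (`TriSurface.exists_positive_curve_energy_le`). For positive `μ`, the squared
tangent norm is the supremum of `⟨ψ, M_V δ⟩ - ½ ⟨Gψ, M_T M_μ̂ Gψ⟩` over `ψ`, which is jointly convex
in `(μ, δ)`. Mixing an optimal curve with a small multiple of the segment between its positive ends
therefore yields positive curves whose energy is arbitrarily close to the optimal action.
-/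

/-! ### Factoring a quadratically bounded functional through a linear map -/

/-- If a linear functional `Λ` satisfies `Λ x - ½ ‖J x‖² ≤ W` for all `x`, then it is represented
by a vector `u` of energy at most `W`: the bound forces `|Λ x|² ≤ 2 W ‖J x‖²`, so that `Λ` descends
to a bounded functional on the range of `J`, to which Hahn-Banach and Riesz apply. -/
theorem exists_inner_eq_of_sub_half_sq_le {E H : Type*} [AddCommGroup E] [Module ℝ E]
    [NormedAddCommGroup H] [InnerProductSpace ℝ H] [CompleteSpace H]
    (J : E →ₗ[ℝ] H) (Λ : E →ₗ[ℝ] ℝ) {W : ℝ} (h : ∀ x, Λ x - (1 / 2) * ‖J x‖ ^ 2 ≤ W) :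
    ∃ u : H, (∀ x, Λ x = inner ℝ u (J x)) ∧ (1 / 2) * ‖u‖ ^ 2 ≤ W := by
  have hW : 0 ≤ W := by simpa using h 0
  have hsq : ∀ x, Λ x ≤ Real.sqrt (2 * W) * ‖J x‖ := by
    intro x
    -- the quadratic polynomial `s ↦ ½ ‖J x‖² s² - Λ x s + W` is nonnegative
    have hd : discrim ((1 / 2) * ‖J x‖ ^ 2) (-Λ x) W ≤ 0 := by
      apply discrim_le_zero
      intro s
      have := h (s • x)
      rw [map_smul, map_smul, norm_smul, mul_pow, Real.norm_eq_abs, sq_abs, smul_eq_mul] at this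
      nlinarith
    rw [discrim] at hd
    rw [← Real.sqrt_sq (norm_nonneg (J x)), ← Real.sqrt_mul (by positivity)]
    apply Real.le_sqrt_of_sq_le
    nlinarith
  have hker : Λ ∈ (LinearMap.ker J).dualAnnihilator := by
    rw [Submodule.mem_dualAnnihilator]
    intro x hx
    rw [LinearMap.mem_ker] at hx
    have h1 := hsq x
    have h2 := hsq (-x)
    rw [map_neg, map_neg] at h2
    simp only [hx, neg_zero, norm_zero, mul_zero] at h1 h2
    linarith
  rw [← LinearMap.range_dualMap_eq_dualAnnihilator_ker] at hker
  obtain ⟨g, rfl⟩ := hker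
  have hbd : ∀ y : LinearMap.range J,
      ‖(g.comp (LinearMap.range J).subtype) y‖ ≤ Real.sqrt (2 * W) * ‖y‖ := by
    rintro ⟨_, x, rfl⟩
    rw [Real.norm_eq_abs]
    have := hsq (-x)
    simp only [LinearMap.dualMap_apply, map_neg, norm_neg] at this
    exact abs_le.2 ⟨neg_le.1 this, hsq x⟩
  obtain ⟨G, hG, hGn⟩ := exists_extension_norm_eq (𝕜 := ℝ) (LinearMap.range J)
    ((g.comp (LinearMap.range J).subtype).mkContinuous (Real.sqrt (2 * W)) hbd)
  refine ⟨(InnerProductSpace.toDual ℝ H).symm G, fun x => ?_, ?_⟩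
  · rw [InnerProductSpace.toDual_symm_apply]
    exact (hG ⟨J x, x, rfl⟩).symm
  · rw [LinearIsometryEquiv.norm_map, hGn]
    have h1 := LinearMap.mkContinuous_norm_le (g.comp (LinearMap.range J).subtype)
      (Real.sqrt_nonneg (2 * W)) hbd
    have h2 := pow_le_pow_left₀ (norm_nonneg _) h1 2
    rw [Real.sq_sqrt (by positivity)] at h2
    linarith

theorem exists_abs_le_mul_norm_of_ker_le {E H : Type*} [AddCommGroup E] [Module ℝ E]
    [NormedAddCommGroup H] [InnerProductSpace ℝ H] [FiniteDimensional ℝ H]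
    (J : E →ₗ[ℝ] H) (Λ : E →ₗ[ℝ] ℝ) (h : ∀ x, J x = 0 → Λ x = 0) :
    ∃ M, ∀ x, |Λ x| ≤ M * ‖J x‖ := by
  have hker : Λ ∈ (LinearMap.ker J).dualAnnihilator := by
    rw [Submodule.mem_dualAnnihilator]
    exact fun x hx => h x (LinearMap.mem_ker.1 hx)
  rw [← LinearMap.range_dualMap_eq_dualAnnihilator_ker] at hker
  obtain ⟨g, rfl⟩ := hker
  exact ⟨_, fun x => (LinearMap.toContinuousLinearMap g).le_opNorm (J x)⟩

noncomputable section

namespace TriSurface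

variable (S : TriSurface)

/-! ### Areas, averages and the discrete divergence -/

theorem area_pos (f : S.T) : 0 < S.area f := by
  have hind : AffineIndependent ℝ (S.corner f) := S.nondegenerate f.1 f.2
  have hlin := (affineIndependent_iff_linearIndependent_vsub ℝ _ (0 : Fin 3)).1 hind
  have hpair : LinearIndependent ℝ ![S.corner f 1 - S.corner f 0, S.corner f 2 - S.corner f 0] := by
    have := hlin.comp (fun i : Fin 2 => (⟨i.succ, Fin.succ_ne_zero i⟩ : {x : Fin 3 // x ≠ 0}))
      (fun i j hij => Fin.succ_injective _ (congrArg Subtype.val hij))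
    have heq : ![S.corner f 1 - S.corner f 0, S.corner f 2 - S.corner f 0]
        = (fun i : {x : Fin 3 // x ≠ 0} => S.corner f i -ᵥ S.corner f 0) ∘
          fun i : Fin 2 => (⟨i.succ, Fin.succ_ne_zero i⟩ : {x : Fin 3 // x ≠ 0}) := by
      funext i
      fin_cases i <;> rfl
    rw [heq]
    exact this
  set a := S.corner f 1 - S.corner f 0
  set b := S.corner f 2 - S.corner f 0
  have hlt : |inner ℝ a b| < ‖a‖ * ‖b‖ := by
    refine lt_of_le_of_ne (abs_real_inner_le_norm a b) fun heq => ?_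
    rw [LinearIndependent.pair_iff' (by simpa using hpair.ne_zero 0)] at hpair
    have ha : a ≠ 0 := by
      intro h0
      exact hind.injective.ne (show (1 : Fin 3) ≠ 0 by decide) (sub_eq_zero.1 h0)
    obtain ⟨r, hr⟩ : ∃ r : ℝ, r • a = b := by
      have := (norm_inner_eq_norm_iff (𝕜 := ℝ) ha (y := b) (by
        intro h0
        exact hpair 0 (by rw [zero_smul, h0]))).1 (by rwa [Real.norm_eq_abs])
      obtain ⟨r, -, hr⟩ := this
      exact ⟨r, hr.symm⟩
    exact hpair r hr
  have h3 := sq_lt_sq.2 (hlt.trans_le (le_abs_self _))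
  have : 0 < ‖a‖ ^ 2 * ‖b‖ ^ 2 - inner ℝ a b ^ 2 := by nlinarith
  unfold area
  have := Real.sqrt_pos.2 this
  linarith

theorem mem_facesAt {v : S.V} {f : S.T} : f ∈ S.facesAt v ↔ v ∈ S.vertsOf f := by
  simp [facesAt]

theorem mem_vertsOf {v : S.V} {f : S.T} : v ∈ S.vertsOf f ↔ v ∈ Set.range f.1 := by
  simp [vertsOf]

theorem dualArea_pos (v : S.V) : 0 < S.dualArea v := by
  obtain ⟨f, hf, hv⟩ := S.vertex_mem v
  have : 0 < ∑ f ∈ S.facesAt v, S.area f :=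
    Finset.sum_pos (fun f _ => S.area_pos f)
      ⟨⟨f, hf⟩, S.mem_facesAt.2 (S.mem_vertsOf.2 hv)⟩
  unfold dualArea
  linarith

theorem avg_nonneg {μ : S.V → ℝ} (h : ∀ v, 0 ≤ μ v) (f : S.T) : 0 ≤ S.avg μ f :=
  mul_nonneg (by norm_num) (Finset.sum_nonneg fun v _ => h v)

theorem avg_mono {μ ρ : S.V → ℝ} (h : ∀ v, μ v ≤ ρ v) (f : S.T) : S.avg μ f ≤ S.avg ρ f :=
  mul_le_mul_of_nonneg_left (Finset.sum_le_sum fun v _ => h v) (by norm_num)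

theorem avg_add (μ ρ : S.V → ℝ) (f : S.T) : S.avg (μ + ρ) f = S.avg μ f + S.avg ρ f := by
  simp only [avg, Pi.add_apply, Finset.sum_add_distrib]; ring

theorem avg_smul (c : ℝ) (μ : S.V → ℝ) (f : S.T) : S.avg (c • μ) f = c * S.avg μ f := by
  simp only [avg, Pi.smul_apply, smul_eq_mul, ← Finset.mul_sum]; ring

theorem avg_pos {μ : S.V → ℝ} (h : ∀ v, 0 < μ v) (f : S.T) : 0 < S.avg μ f :=
  mul_pos (by norm_num) (Finset.sum_pos (fun v _ => h v) ⟨f.1 0, S.mem_vertsOf.2 ⟨0, rfl⟩⟩)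

theorem Prob.le_inv {μ : S.V → ℝ} (h : μ ∈ S.Prob) (v : S.V) : μ v ≤ (S.dualArea v)⁻¹ := by
  rw [← one_div, le_div_iff₀ (S.dualArea_pos v), mul_comm, ← h.2]
  exact Finset.single_le_sum (f := fun v => S.dualArea v * μ v)
    (fun u _ => mul_nonneg (S.dualArea_pos u).le (h.1 u)) (Finset.mem_univ v)

theorem convex_prob : Convex ℝ S.Prob := by
  intro μ hμ ρ hρ a b ha hb hab
  refine ⟨fun v => add_nonneg (mul_nonneg ha (hμ.1 v)) (mul_nonneg hb (hρ.1 v)), ?_⟩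
  have : ∑ v, S.dualArea v * (a • μ + b • ρ) v
      = a * ∑ v, S.dualArea v * μ v + b * ∑ v, S.dualArea v * ρ v := by
    rw [Finset.mul_sum, Finset.mul_sum, ← Finset.sum_add_distrib]
    refine Finset.sum_congr rfl fun v _ => ?_
    simp only [Pi.add_apply, Pi.smul_apply, smul_eq_mul]; ring
  rw [this, hμ.2, hρ.2]; linarith

theorem gradAt_add (φ ψ : S.V → ℝ) (f : S.T) :
    S.gradAt (φ + ψ) f = S.gradAt φ f + S.gradAt ψ f :=
  congrFun (S.gradLin.map_add φ ψ) f

theorem gradAt_smul (c : ℝ) (φ : S.V → ℝ) (f : S.T) : S.gradAt (c • φ) f = c • S.gradAt φ f :=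
  congrFun (S.gradLin.map_smul c φ) f

/-- The gradient does not see the addition of a constant. -/
theorem gradAt_congr_sub_const {φ ψ : S.V → ℝ} {c : ℝ} (h : ∀ v, ψ v = φ v - c) (f : S.T) :
    S.gradAt ψ f = S.gradAt φ f := by
  refine S.gradAt_eq (S.gradAt_spec φ f).1 fun i j => ?_
  rw [(S.gradAt_spec φ f).2, h, h]; ring

theorem continuous_gradAt (f : S.T) : Continuous fun φ : S.V → ℝ => S.gradAt φ f :=
  (LinearMap.continuous_of_finiteDimensional
    (LinearMap.proj f ∘ₗ S.gradLin : (S.V → ℝ) →ₗ[ℝ] EuclideanSpace ℝ (Fin 3)))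

/-- The pairing of a potential with a variation of density, `⟨ψ, M_V δ⟩`. -/
def pair (ψ δ : S.V → ℝ) : ℝ := ∑ v, S.dualArea v * ψ v * δ v

/-- The Dirichlet energy `⟨Gψ, M_T M_μ̂ Gψ⟩` of a potential `ψ` with respect to the density `μ`. -/
def dirichlet (μ ψ : S.V → ℝ) : ℝ := ∑ f, S.area f * S.avg μ f * ‖S.gradAt ψ f‖ ^ 2

theorem pair_add_left (φ ψ δ : S.V → ℝ) : S.pair (φ + ψ) δ = S.pair φ δ + S.pair ψ δ := by
  simp only [pair, Pi.add_apply, ← Finset.sum_add_distrib]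
  exact Finset.sum_congr rfl fun v _ => by ring

theorem pair_smul_left (c : ℝ) (ψ δ : S.V → ℝ) : S.pair (c • ψ) δ = c * S.pair ψ δ := by
  simp only [pair, Pi.smul_apply, smul_eq_mul, Finset.mul_sum]
  exact Finset.sum_congr rfl fun v _ => by ring

theorem pair_add_right (ψ δ η : S.V → ℝ) : S.pair ψ (δ + η) = S.pair ψ δ + S.pair ψ η := by
  simp only [pair, Pi.add_apply, ← Finset.sum_add_distrib]
  exact Finset.sum_congr rfl fun v _ => by ring

theorem pair_smul_right (c : ℝ) (ψ δ : S.V → ℝ) : S.pair ψ (c • δ) = c * S.pair ψ δ := by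
  simp only [pair, Pi.smul_apply, smul_eq_mul, Finset.mul_sum]
  exact Finset.sum_congr rfl fun v _ => by ring

theorem dirichlet_add_left (μ ρ ψ : S.V → ℝ) :
    S.dirichlet (μ + ρ) ψ = S.dirichlet μ ψ + S.dirichlet ρ ψ := by
  simp only [dirichlet, avg_add, ← Finset.sum_add_distrib]
  exact Finset.sum_congr rfl fun v _ => by ring

theorem dirichlet_smul_left (c : ℝ) (μ ψ : S.V → ℝ) :
    S.dirichlet (c • μ) ψ = c * S.dirichlet μ ψ := by
  simp only [dirichlet, avg_smul, Finset.mul_sum]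
  exact Finset.sum_congr rfl fun v _ => by ring

/-- The term `(∑_{f ∈ T_v} |f| x_f) / (3|v|)` at the vertex `v`, which for `x_f = ‖(Gφ)_f‖²` is
the Hamiltonian of the discrete Hamilton-Jacobi inequality. -/
def vertexMean (x : S.T → ℝ) (v : S.V) : ℝ :=
  (∑ f ∈ S.facesAt v, S.area f * x f) / (3 * S.dualArea v)

/-- The average over the triangles around a vertex is adjoint to the average `avg` over the vertices
of a triangle. -/
theorem sum_vertexMean (μ : S.V → ℝ) (x : S.T → ℝ) :
    ∑ v, S.dualArea v * μ v * S.vertexMean x v = ∑ f, S.area f * S.avg μ f * x f := by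
  classical
  have h1 : ∀ v, S.dualArea v * μ v * S.vertexMean x v
      = ∑ f, if v ∈ S.vertsOf f then (1 / 3) * μ v * (S.area f * x f) else 0 := by
    intro v
    have := (S.dualArea_pos v).ne'
    rw [← Finset.sum_filter, ← Finset.mul_sum, vertexMean]
    have : (Finset.univ.filter fun f => v ∈ S.vertsOf f) = S.facesAt v := by
      ext f; simp [mem_facesAt]
    rw [this]
    field_simp
  simp_rw [h1]
  rw [Finset.sum_comm]
  refine Finset.sum_congr rfl fun f _ => ?_
  rw [← Finset.sum_filter, Finset.filter_mem_eq_inter, Finset.univ_inter, avg, Finset.mul_sum,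
    Finset.mul_sum, Finset.sum_mul]
  exact Finset.sum_congr rfl fun v _ => by ring

theorem sum_vertexMean_sq (μ φ : S.V → ℝ) :
    ∑ v, S.dualArea v * μ v * S.vertexMean (fun f => ‖S.gradAt φ f‖ ^ 2) v = S.dirichlet μ φ :=
  S.sum_vertexMean μ _

theorem vertexMean_nonneg {x : S.T → ℝ} (h : ∀ f, 0 ≤ x f) (v : S.V) : 0 ≤ S.vertexMean x v :=
  div_nonneg (Finset.sum_nonneg fun f _ => mul_nonneg (S.area_pos f).le (h f))
    (by linarith [S.dualArea_pos v])

theorem MV_mulVec (μ : S.V → ℝ) (v : S.V) : (S.MV *ᵥ μ) v = S.dualArea v * μ v := by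
  classical
  rw [MV, Matrix.mulVec_diagonal]

/-- `-Gᵀ M_T` is the discrete divergence: the adjoint of the gradient. -/
theorem sum_mul_GT_MT (ψ : S.V → ℝ) (x : S.T → EuclideanSpace ℝ (Fin 3)) :
    ∑ v, ψ v * ((S.Gᵀ * S.MT) *ᵥ fun p => x p.1 p.2) v
      = ∑ f, S.area f * inner ℝ (S.gradAt ψ f) (x f) := by
  classical
  have h1 : (∑ v, ψ v * ((S.Gᵀ * S.MT) *ᵥ fun p => x p.1 p.2) v)
      = (S.G *ᵥ ψ) ⬝ᵥ (S.MT *ᵥ fun p => x p.1 p.2) := by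
    change ψ ⬝ᵥ _ = _
    rw [← Matrix.mulVec_mulVec, Matrix.dotProduct_mulVec, Matrix.vecMul_transpose]
  rw [h1, dotProduct, Fintype.sum_prod_type]
  refine Finset.sum_congr rfl fun f _ => ?_
  rw [PiLp.inner_apply, Finset.mul_sum]
  refine Finset.sum_congr rfl fun k _ => ?_
  rw [G_mulVec, MT, Matrix.mulVec_diagonal]
  simp only [RCLike.inner_apply, conj_trivial]
  ring

theorem pair_eq_of_MV_eq {δ : S.V → ℝ} {x : S.T → EuclideanSpace ℝ (Fin 3)}
    (h : ∀ v, (S.MV *ᵥ δ) v = ((S.Gᵀ * S.MT) *ᵥ fun p => x p.1 p.2) v) (ψ : S.V → ℝ) :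
    S.pair ψ δ = ∑ f, S.area f * inner ℝ (S.gradAt ψ f) (x f) := by
  rw [← S.sum_mul_GT_MT]
  refine Finset.sum_congr rfl fun v _ => ?_
  rw [← h, MV_mulVec]; ring

open Classical in
theorem MV_eq_of_pair_eq {δ : S.V → ℝ} {x : S.T → EuclideanSpace ℝ (Fin 3)}
    (h : ∀ ψ, S.pair ψ δ = ∑ f, S.area f * inner ℝ (S.gradAt ψ f) (x f)) (v : S.V) :
    (S.MV *ᵥ δ) v = ((S.Gᵀ * S.MT) *ᵥ fun p => x p.1 p.2) v := by
  have := h (Pi.single v 1)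
  rw [← S.sum_mul_GT_MT] at this
  simpa [pair, Pi.single_apply, MV_mulVec] using this

/-! ### The tangent norm as a supremum over potentials -/

theorem pair_sub_half_dirichlet_le {μ δ : S.V → ℝ} (hμ : ∀ v, 0 ≤ μ v)
    {x : S.T → EuclideanSpace ℝ (Fin 3)}
    (h : ∀ ψ, S.pair ψ δ = ∑ f, S.area f * inner ℝ (S.gradAt ψ f) (S.avg μ f • x f))
    (ψ : S.V → ℝ) :
    S.pair ψ δ - (1 / 2) * S.dirichlet μ ψ
      ≤ ∑ f, (1 / 2) * ‖x f‖ ^ 2 * S.area f * S.avg μ f := by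
  rw [h, dirichlet, Finset.mul_sum, ← Finset.sum_sub_distrib]
  refine Finset.sum_le_sum fun f _ => ?_
  rw [inner_smul_right]
  have h1 : inner ℝ (S.gradAt ψ f) (x f) ≤ (1 / 2) * ‖S.gradAt ψ f‖ ^ 2 + (1 / 2) * ‖x f‖ ^ 2 := by
    nlinarith [real_inner_le_norm (S.gradAt ψ f) (x f), sq_nonneg (‖S.gradAt ψ f‖ - ‖x f‖)]
  have h2 : 0 ≤ S.area f * S.avg μ f := mul_nonneg (S.area_pos f).le (S.avg_nonneg hμ f)
  nlinarith [mul_le_mul_of_nonneg_left h1 h2]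

theorem GMG_mulVec (μ φ : S.V → ℝ) :
    -((S.Gᵀ * S.MT * S.Mavg μ * S.G) *ᵥ φ)
      = (S.Gᵀ * S.MT) *ᵥ fun p => (S.avg μ p.1 • -S.gradAt φ p.1) p.2 := by
  classical
  rw [← Matrix.mulVec_mulVec, ← Matrix.mulVec_mulVec, ← Matrix.mulVec_neg]
  congr 1
  funext p
  rw [Pi.neg_apply, Mavg, Matrix.mulVec_diagonal, G_mulVec]
  simp

theorem le_tangentNormSq {μ δ : S.V → ℝ} (hμ : ∀ v, 0 ≤ μ v) (ψ : S.V → ℝ) :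
    ENNReal.ofReal (S.pair ψ δ - (1 / 2) * S.dirichlet μ ψ) ≤ S.tangentNormSq μ δ := by
  refine le_iInf₂ fun φ hφ => ENNReal.ofReal_le_ofReal ?_
  rw [S.GMG_mulVec] at hφ
  have := S.pair_sub_half_dirichlet_le hμ
    (S.pair_eq_of_MV_eq (x := fun f => S.avg μ f • -S.gradAt φ f) fun v => congrFun hφ v) ψ
  refine this.trans (le_of_eq ?_)
  rw [Finset.mul_sum]
  exact Finset.sum_congr rfl fun f _ => by rw [norm_neg]; ring

/-- The map `ψ ↦ (√(|f| μ̂_f) (Gψ)_f)_f`, whose squared norm is the Dirichlet energy. -/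
def weightedGrad (μ : S.V → ℝ) :
    (S.V → ℝ) →ₗ[ℝ] PiLp 2 fun _ : S.T => EuclideanSpace ℝ (Fin 3) where
  toFun ψ := WithLp.toLp 2 fun f => Real.sqrt (S.area f * S.avg μ f) • S.gradAt ψ f
  map_add' φ ψ := by
    ext1 f
    simp [gradAt_add]
  map_smul' c ψ := by
    ext1 f
    simp [gradAt_smul, smul_comm c]

theorem norm_weightedGrad_sq {μ : S.V → ℝ} (hμ : ∀ v, 0 ≤ μ v) (ψ : S.V → ℝ) :
    ‖S.weightedGrad μ ψ‖ ^ 2 = S.dirichlet μ ψ := by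
  rw [PiLp.norm_sq_eq_of_L2]
  refine Finset.sum_congr rfl fun f _ => ?_
  change ‖Real.sqrt (S.area f * S.avg μ f) • S.gradAt ψ f‖ ^ 2 = _
  rw [norm_smul, mul_pow, Real.norm_eq_abs, sq_abs,
    Real.sq_sqrt (mul_nonneg (S.area_pos f).le (S.avg_nonneg hμ f))]

/-- Lax-Milgram: a dual bound is realized by a solution of the elliptic equation. The representing
vector is projected onto the range of the weighted gradient, which is closed since it has finite
dimension. -/
theorem tangentNormSq_le {μ δ : S.V → ℝ} (hμ : ∀ v, 0 ≤ μ v) {A : ℝ}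
    (h : ∀ ψ, S.pair ψ δ - (1 / 2) * S.dirichlet μ ψ ≤ A) :
    S.tangentNormSq μ δ ≤ ENNReal.ofReal A := by
  let Λ : (S.V → ℝ) →ₗ[ℝ] ℝ :=
    { toFun := fun ψ => S.pair ψ δ
      map_add' := fun φ ψ => S.pair_add_left φ ψ δ
      map_smul' := fun c ψ => S.pair_smul_left c ψ δ }
  obtain ⟨u, hu, hun⟩ := exists_inner_eq_of_sub_half_sq_le (S.weightedGrad μ) Λ (W := A)
    fun ψ => by rw [S.norm_weightedGrad_sq hμ]; exact h ψ
  let K := LinearMap.range (S.weightedGrad μ)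
  obtain ⟨φ, hφ⟩ : K.starProjection u ∈ K := K.starProjection_apply_mem u
  refine (iInf₂_le (-φ) ?_).trans (ENNReal.ofReal_le_ofReal (le_trans ?_ hun))
  · rw [S.GMG_mulVec]
    funext v
    refine S.MV_eq_of_pair_eq (x := fun f => S.avg μ f • -S.gradAt (-φ) f) (fun ψ => ?_) v
    have h1 : S.pair ψ δ = inner ℝ (S.weightedGrad μ φ) (S.weightedGrad μ ψ) := by
      rw [hφ]
      have : inner ℝ (K.starProjection u) (S.weightedGrad μ ψ)
          = inner ℝ u (S.weightedGrad μ ψ) := by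
        rw [K.inner_starProjection_left_eq_right,
          K.starProjection_eq_self_iff.2 (LinearMap.mem_range_self _ ψ)]
      rw [this]
      exact hu ψ
    rw [h1, PiLp.inner_apply]
    refine Finset.sum_congr rfl fun f _ => ?_
    change inner ℝ (Real.sqrt (S.area f * S.avg μ f) • S.gradAt φ f)
      (Real.sqrt (S.area f * S.avg μ f) • S.gradAt ψ f) = _
    have h2 : S.gradAt (-φ) f = -S.gradAt φ f := by simpa using S.gradAt_smul (-1) φ f
    rw [real_inner_smul_left, real_inner_smul_right, inner_smul_right, h2, neg_neg, ← mul_assoc,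
      Real.mul_self_sqrt (mul_nonneg (S.area_pos f).le (S.avg_nonneg hμ f)), real_inner_comm]
    ring
  · have h1 : ‖S.weightedGrad μ φ‖ ≤ ‖u‖ := by
      rw [hφ]
      exact K.norm_starProjection_apply_le u
    have h2 := pow_le_pow_left₀ (norm_nonneg _) h1 2
    rw [S.norm_weightedGrad_sq hμ] at h2
    have h3 : (∑ f, ‖S.gradAt (-φ) f‖ ^ 2 * S.area f * S.avg μ f) = S.dirichlet μ φ := by
      refine Finset.sum_congr rfl fun f _ => ?_
      have h2 : S.gradAt (-φ) f = -S.gradAt φ f := by simpa using S.gradAt_smul (-1) φ f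
      rw [h2, norm_neg]; ring
    rw [h3]
    linarith

/-- If every potential with vanishing gradient annihilates `δ`, then `δ` has finite tangent norm at
every positive density, with a bound that is quadratic in `δ` and inverse to the density. -/
theorem exists_pair_sub_half_dirichlet_le {δ : S.V → ℝ}
    (h : ∀ ψ, (∀ f, S.gradAt ψ f = 0) → S.pair ψ δ = 0) :
    ∃ C, ∀ (μ : S.V → ℝ) (c : ℝ), 0 < c → (∀ v, c ≤ μ v) → ∀ (s : ℝ) (ψ : S.V → ℝ),
      s * S.pair ψ δ - (1 / 2) * S.dirichlet μ ψ ≤ C * (s ^ 2 / c) := by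
  let Λ : (S.V → ℝ) →ₗ[ℝ] ℝ :=
    { toFun := fun ψ => S.pair ψ δ
      map_add' := fun φ ψ => S.pair_add_left φ ψ δ
      map_smul' := fun c ψ => S.pair_smul_left c ψ δ }
  obtain ⟨M, hM⟩ := exists_abs_le_mul_norm_of_ker_le (S.weightedGrad 1) Λ fun ψ hψ => by
    refine h ψ fun f => ?_
    have h1 : Real.sqrt (S.area f * S.avg 1 f) • S.gradAt ψ f = 0 :=
      congrArg (fun y : PiLp 2 fun _ : S.T => EuclideanSpace ℝ (Fin 3) => y f) hψ
    refine (smul_eq_zero.1 h1).resolve_left (Real.sqrt_pos.2 ?_).ne'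
    exact mul_pos (S.area_pos f) (S.avg_pos (fun _ => one_pos) f)
  refine ⟨(1 / 2) * M ^ 2, fun μ c hc hμ s ψ => ?_⟩
  have h1 : |S.pair ψ δ| ≤ M * ‖S.weightedGrad 1 ψ‖ := hM ψ
  have hd := S.norm_weightedGrad_sq (μ := 1) (fun _ => zero_le_one) ψ
  generalize ‖S.weightedGrad 1 ψ‖ = d at h1 hd
  have h2 : c * d ^ 2 ≤ S.dirichlet μ ψ := by
    rw [hd, ← S.dirichlet_smul_left]
    refine Finset.sum_le_sum fun f _ => ?_
    refine mul_le_mul_of_nonneg_right (mul_le_mul_of_nonneg_left ?_ (S.area_pos f).le) (sq_nonneg _)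
    exact S.avg_mono (fun v => by simpa using hμ v) f
  have h3 : s * S.pair ψ δ ≤ |s| * (M * d) := by
    refine (le_abs_self _).trans ?_
    rw [abs_mul]
    exact mul_le_mul_of_nonneg_left h1 (abs_nonneg s)
  -- Young's inequality `|s| M d ≤ ½ (|s| M)² / c + ½ c d²`
  have h4 : |s| * (M * d) ≤ 1 / 2 * M ^ 2 * (s ^ 2 / c) + (1 / 2) * (c * d ^ 2) := by
    have h5 : 1 / 2 * M ^ 2 * (s ^ 2 / c) + (1 / 2) * (c * d ^ 2) - |s| * (M * d)
        = (1 / 2) * (|s| * M - c * d) ^ 2 / c := by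
      field_simp
      rw [← sq_abs s]
      ring
    have : 0 ≤ (1 / 2) * (|s| * M - c * d) ^ 2 / c := by positivity
    linarith
  linarith

end TriSurface

end

/-! ### Absolutely continuous functions on the unit interval -/

theorem AbsolutelyContinuousOnInterval.congr {X : Type*} [PseudoMetricSpace X] {f g : ℝ → X}
    {a b : ℝ} (hf : AbsolutelyContinuousOnInterval f a b) (h : EqOn f g (uIcc a b)) :
    AbsolutelyContinuousOnInterval g a b := by
  rw [absolutelyContinuousOnInterval_iff] at hf ⊢
  intro ε hε
  obtain ⟨δ, hδ, H⟩ := hf ε hε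
  refine ⟨δ, hδ, fun E hE hlt => ?_⟩
  convert H E hE hlt using 1
  refine Finset.sum_congr rfl fun i hi => ?_
  rw [h (hE.1 i hi).1, h (hE.1 i hi).2]

theorem AbsolutelyContinuousOnInterval.const {X : Type*} [PseudoMetricSpace X] (c : X) (a b : ℝ) :
    AbsolutelyContinuousOnInterval (fun _ => c) a b :=
  LipschitzOnWith.absolutelyContinuousOnInterval (K := 0)
    (LipschitzWith.const c).lipschitzOnWith

/-- A differentiable function with nonpositive derivative is absolutely continuous, although its
derivative need not be continuous: by monotonicity the derivative is integrable. -/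
theorem absolutelyContinuousOnInterval_of_derivWithin_nonpos {f : ℝ → ℝ}
    (hf : DifferentiableOn ℝ f (Icc 0 1))
    (h : ∀ t ∈ Icc (0 : ℝ) 1, derivWithin f (Icc 0 1) t ≤ 0) :
    AbsolutelyContinuousOnInterval f 0 1 := by
  have hd : ∀ t ∈ Ioo (0 : ℝ) 1, HasDerivAt f (derivWithin f (Icc 0 1) t) t := fun t ht =>
    ((hf t (Ioo_subset_Icc_self ht)).hasDerivWithinAt).hasDerivAt (Icc_mem_nhds ht.1 ht.2)
  have hint : IntervalIntegrable (fun t => derivWithin f (Icc 0 1) t) volume 0 1 := by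
    have h1 : IntervalIntegrable (fun t => -derivWithin f (Icc 0 1) t) volume 0 1 := by
      refine intervalIntegral.intervalIntegrable_deriv_of_nonneg (g := fun t => -f t) ?_ ?_ ?_
      · rw [uIcc_of_le zero_le_one]
        exact hf.continuousOn.neg
      · intro t ht
        rw [min_eq_left zero_le_one, max_eq_right zero_le_one] at ht
        exact (hd t ht).neg
      · intro t ht
        rw [min_eq_left zero_le_one, max_eq_right zero_le_one] at ht
        exact neg_nonneg.2 (h t (Ioo_subset_Icc_self ht))
    simpa only [Pi.neg_def, neg_neg] using h1.neg
  have hac := (hint.absolutelyContinuousOnInterval_intervalIntegral (c := 0) (by simp)).fun_add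
    (AbsolutelyContinuousOnInterval.const (f 0) 0 1)
  refine hac.congr fun t ht => ?_
  rw [uIcc_of_le zero_le_one] at ht
  have := intervalIntegral.integral_eq_sub_of_hasDerivAt_of_le ht.1
    (hf.continuousOn.mono (Icc_subset_Icc_right ht.2))
    (fun s hs => hd s ⟨hs.1, hs.2.trans_le ht.2⟩)
    (hint.mono_set (by
      rw [uIcc_of_le ht.1, uIcc_of_le zero_le_one]
      exact Icc_subset_Icc_right ht.2))
  simp only [this]; ring

theorem ofReal_integral_le_lintegral_ofReal {α : Type*} [MeasurableSpace α] {m : Measure α}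
    {f : α → ℝ} (hf : Integrable f m) :
    ENNReal.ofReal (∫ a, f a ∂m) ≤ ∫⁻ a, ENNReal.ofReal (f a) ∂m := by
  have h1 : ∫ a, f a ∂m ≤ ∫ a, max (f a) 0 ∂m :=
    integral_mono hf hf.pos_part fun a => le_max_left _ _
  refine (ENNReal.ofReal_le_ofReal h1).trans ?_
  rw [ofReal_integral_eq_lintegral_ofReal hf.pos_part (.of_forall fun a => le_max_right _ _)]
  exact lintegral_mono fun a => by simp [ENNReal.ofReal_max]

noncomputable section

namespace TriSurface

variable (S : TriSurface)

/-! ### Weak duality -/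

theorem ae_mem_Ioo : ∀ᵐ t ∂(volume.restrict (Icc (0 : ℝ) 1)), t ∈ Ioo (0 : ℝ) 1 := by
  rw [← restrict_Ioo_eq_restrict_Icc]
  exact ae_restrict_mem measurableSet_Ioo

theorem IsCurve.ae_hasDerivAt {S : TriSurface} {μ₀ μ₁ : S.V → ℝ} {μ : ℝ → S.V → ℝ}
    (h : S.IsCurve μ₀ μ₁ μ) : ∀ᵐ t ∂(volume.restrict (Icc (0 : ℝ) 1)), ∀ v,
      HasDerivAt (fun s => μ s v) (deriv (fun s => μ s v) t) t := by
  refine ae_all_iff.2 fun v => (ae_restrict_iff' measurableSet_Icc).2 ?_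
  filter_upwards [(h.absCont v).ae_differentiableAt] with t ht htI
  rw [uIcc_of_le zero_le_one] at ht
  exact (ht htI).hasDerivAt

/-- Weak duality, for curves: any pointwise bound `e` of the dual expression of the squared speed
bounds the Wasserstein distance. Along the curve, the derivative of `⟨φ, M_V μ⟩` is at most
`⟨φ, M_V ∂ₜμ⟩ - ½ ⟨Gφ, M_T M_μ̂ Gφ⟩` by the Hamilton-Jacobi inequality. -/
theorem wassersteinSq_le_lintegral {μ₀ μ₁ : S.V → ℝ} {μ : ℝ → S.V → ℝ}
    (hμ : S.IsCurve μ₀ μ₁ μ) {e : ℝ → ℝ≥0∞}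
    (he : ∀ᵐ t ∂(volume.restrict (Icc (0 : ℝ) 1)), ∀ ψ,
      ENNReal.ofReal (S.pair ψ (fun v => deriv (fun s => μ s v) t)
        - (1 / 2) * S.dirichlet (μ t) ψ) ≤ e t) :
    S.wassersteinSq μ₀ μ₁ ≤ ((∫⁻ t in Icc (0 : ℝ) 1, e t : ℝ≥0∞) : EReal) := by
  refine iSup₂_le fun φ hφ => ?_
  have hnn : ∀ t v, 0 ≤ S.vertexMean (fun f => ‖S.gradAt (φ t) f‖ ^ 2) v :=
    fun t v => S.vertexMean_nonneg (fun f => sq_nonneg _) v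
  have hHJ : ∀ t ∈ Icc (0 : ℝ) 1, ∀ v, derivWithin (fun s => φ s v) (Icc 0 1) t
      ≤ -((1 / 2) * S.vertexMean (fun f => ‖S.gradAt (φ t) f‖ ^ 2) v) := fun t ht v =>
    le_neg_iff_add_nonpos_right.2 (hφ.2 t ht v)
  have hφac : ∀ v, AbsolutelyContinuousOnInterval (fun t => φ t v) 0 1 := fun v =>
    absolutelyContinuousOnInterval_of_derivWithin_nonpos (hφ.1 v) fun t ht => by
      linarith [hHJ t ht v, hnn t v]
  let F : ℝ → ℝ := fun t => ∑ v, S.dualArea v * (deriv (fun s => φ s v) t * μ t v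
    + φ t v * deriv (fun s => μ s v) t)
  have hint : ∀ v, IntervalIntegrable (fun t => deriv (fun s => φ s v) t * μ t v
    + φ t v * deriv (fun s => μ s v) t) volume 0 1 := fun v =>
    ((hφac v).intervalIntegrable_deriv.mul_continuousOn (hμ.absCont v).continuousOn).add
      ((hμ.absCont v).intervalIntegrable_deriv.continuousOn_mul (hφac v).continuousOn)
  have hF : ∫ t in (0 : ℝ)..1, F t
      = ∑ v, S.dualArea v * φ 1 v * μ₁ v - ∑ v, S.dualArea v * φ 0 v * μ₀ v := by
    rw [intervalIntegral.integral_finsetSum fun v _ => (hint v).const_mul _,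
      ← Finset.sum_sub_distrib]
    refine Finset.sum_congr rfl fun v _ => ?_
    rw [intervalIntegral.integral_const_mul, (hφac v).integral_deriv_mul_eq_sub (hμ.absCont v),
      hμ.start, hμ.finish]
    ring
  have hFint : Integrable F (volume.restrict (Icc (0 : ℝ) 1)) := by
    have := IntervalIntegrable.sum Finset.univ fun v _ => (hint v).const_mul (S.dualArea v)
    rw [intervalIntegrable_iff_integrableOn_Icc_of_le zero_le_one] at this
    refine this.congr (.of_forall fun t => ?_)
    simp [F]
  have hFle : ∀ᵐ t ∂(volume.restrict (Icc (0 : ℝ) 1)), ENNReal.ofReal (F t) ≤ e t := by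
    filter_upwards [he, ae_mem_Ioo] with t ht htI
    refine (ENNReal.ofReal_le_ofReal ?_).trans (ht (φ t))
    have hmem := Ioo_subset_Icc_self htI
    rw [← S.sum_vertexMean_sq, pair, Finset.mul_sum, ← Finset.sum_sub_distrib]
    refine Finset.sum_le_sum fun v _ => ?_
    have h1 := hHJ t hmem v
    rw [derivWithin_of_mem_nhds (Icc_mem_nhds htI.1 htI.2)] at h1
    have h2 : 0 ≤ S.dualArea v * μ t v :=
      mul_nonneg (S.dualArea_pos v).le ((hμ.mem_prob t hmem).1 v)
    nlinarith [mul_le_mul_of_nonneg_left h1 h2]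
  rw [← hF, intervalIntegral.integral_of_le zero_le_one, ← integral_Icc_eq_integral_Ioc]
  refine (le_trans ?_ (EReal.coe_ennreal_le_coe_ennreal_iff.2
    ((ofReal_integral_le_lintegral_ofReal hFint).trans (lintegral_mono_ae hFle))))
  rw [EReal.coe_ennreal_ofReal]
  exact EReal.coe_le_coe_iff.2 (le_max_left _ _)

theorem wassersteinSq_le_energy {μ₀ μ₁ : S.V → ℝ} {μ : ℝ → S.V → ℝ}
    (hμ : S.IsCurve μ₀ μ₁ μ) : S.wassersteinSq μ₀ μ₁ ≤ (S.energy μ : EReal) :=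
  S.wassersteinSq_le_lintegral hμ <| (ae_restrict_mem measurableSet_Icc).mono fun t ht ψ =>
    S.le_tangentNormSq (hμ.mem_prob t ht).1 ψ

/-- The continuity equation bounds the dual expression of the squared speed of the curve. -/
theorem IsAdmissible.ae_pair_sub_le {S : TriSurface} {μ₀ μ₁ : S.V → ℝ} {μ : ℝ → S.V → ℝ}
    {w : ℝ → S.T → EuclideanSpace ℝ (Fin 3)} (h : S.IsAdmissible μ₀ μ₁ μ w) :
    ∀ᵐ t ∂(volume.restrict (Icc (0 : ℝ) 1)), ∀ ψ,
      S.pair ψ (fun v => deriv (fun s => μ s v) t) - (1 / 2) * S.dirichlet (μ t) ψ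
        ≤ ∑ f, (1 / 2) * ‖w t f‖ ^ 2 * S.area f * S.avg (μ t) f := by
  filter_upwards [h.continuity, ae_restrict_mem measurableSet_Icc] with t ht htI ψ
  refine S.pair_sub_half_dirichlet_le (h.isCurve.mem_prob t htI).1 (fun ψ => ?_) ψ
  refine S.pair_eq_of_MV_eq (fun v => ?_) ψ
  have h1 := (ht v).deriv
  simp_rw [S.MV_mulVec] at h1 ⊢
  rw [deriv_const_mul_field'] at h1
  exact h1

theorem wassersteinSq_le_action {μ₀ μ₁ : S.V → ℝ} {μ : ℝ → S.V → ℝ}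
    {w : ℝ → S.T → EuclideanSpace ℝ (Fin 3)} (h : S.IsAdmissible μ₀ μ₁ μ w) :
    S.wassersteinSq μ₀ μ₁ ≤ (S.action μ w : EReal) :=
  S.wassersteinSq_le_lintegral h.isCurve <| h.ae_pair_sub_le.mono fun _ ht ψ =>
    ENNReal.ofReal_le_ofReal (ht ψ)

theorem wassersteinSq_nonneg (μ₀ μ₁ : S.V → ℝ) : 0 ≤ S.wassersteinSq μ₀ μ₁ := by
  have h0 : ∀ f, S.gradAt 0 f = 0 := fun f => congrFun S.gradLin.map_zero f
  have : S.IsSubsolution fun _ => 0 := by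
    refine ⟨fun v => differentiableOn_const _, fun t _ v => ?_⟩
    simp [h0]
  refine le_trans (le_of_eq ?_) (le_iSup₂ (fun _ => (0 : S.V → ℝ)) this)
  simp

end TriSurface

end

/-! ### A minimax principle -/

/-- A consequence of Sion's minimax theorem in which only the first variable ranges over a compact
set: if `L x y ≤ W` can be achieved, up to any error, for each `y` separately, then some `x`
achieves it for all `y`. By compactness finitely many `y` suffice, and for these the minimax theorem
applies to the mixtures `∑ λᵢ L x yᵢ ≤ L x (∑ λᵢ yᵢ)`. -/
theorem exists_forall_le_of_forall_exists_le {E F : Type*} [AddCommGroup E] [Module ℝ E]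
    [TopologicalSpace E] [IsTopologicalAddGroup E] [ContinuousSMul ℝ E] [AddCommGroup F]
    [Module ℝ F] {X : Set E} (hXc : IsCompact X) (hXconv : Convex ℝ X) (hXne : X.Nonempty)
    {L : E → F → ℝ} (hcont : ∀ y, Continuous fun x => L x y)
    (hconv : ∀ y, ConvexOn ℝ X fun x => L x y) (hconc : ∀ x ∈ X, ConcaveOn ℝ univ (L x)) {W : ℝ}
    (h : ∀ y, ∀ ε > 0, ∃ x ∈ X, L x y ≤ W + ε) : ∃ x ∈ X, ∀ y, L x y ≤ W := by
  have h' : ∀ y, ∃ x ∈ X, L x y ≤ W := by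
    intro y
    obtain ⟨x, hx, hmin⟩ := hXc.exists_isMinOn hXne (hcont y).continuousOn
    refine ⟨x, hx, le_of_forall_pos_le_add fun ε hε => ?_⟩
    obtain ⟨x', hx', hle⟩ := h y ε hε
    exact (hmin hx').trans hle
  have key := hXc.inter_iInter_nonempty (fun y => {x | L x y ≤ W})
    (fun y => isClosed_le (hcont y) continuous_const) fun u => by
      rcases u.eq_empty_or_nonempty with rfl | hu
      · simpa using hXne
      obtain ⟨y₀, hy₀⟩ := hu
      classical
      have hcontsum : ∀ c : u → ℝ, Continuous fun x => ∑ i, c i * L x i := fun c =>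
        continuous_finsetSum _ fun i _ => continuous_const.mul (hcont i)
      obtain ⟨a, ha, b, hb, hab⟩ := Sion.exists_isSaddlePointOn (X := X) (Y := stdSimplex ℝ u)
        (f := fun x c => ∑ i, c i * L x i) hXne hXconv hXc
        (fun c _ => (hcontsum c).lowerSemicontinuous.lowerSemicontinuousOn _)
        (fun c hc => ConvexOn.quasiconvexOn ⟨hXconv, fun x hx x' hx' p q hp hq hpq => by
          simp only [smul_eq_mul, Finset.mul_sum, ← Finset.sum_add_distrib]
          refine Finset.sum_le_sum fun i _ => ?_
          have := mul_le_mul_of_nonneg_left ((hconv i).2 hx hx' hp hq hpq) (hc.1 i)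
          simp only [smul_eq_mul] at this
          linarith⟩)
        (convex_stdSimplex ℝ u)
        ⟨_, single_mem_stdSimplex ℝ (⟨y₀, hy₀⟩ : u)⟩ (isCompact_stdSimplex ℝ u)
        (fun x _ => (continuous_finsetSum _ fun i _ =>
          (continuous_apply i).mul continuous_const).upperSemicontinuous.upperSemicontinuousOn _)
        (fun x _ => ConcaveOn.quasiconcaveOn ⟨convex_stdSimplex ℝ u,
          fun c _ c' _ p q _ _ _ => le_of_eq (by
            simp only [smul_eq_mul, Finset.mul_sum, ← Finset.sum_add_distrib, Pi.add_apply,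
              Pi.smul_apply]
            exact Finset.sum_congr rfl fun i _ => by ring)⟩)
      refine ⟨a, ha, ?_⟩
      simp only [mem_iInter]
      intro y hy
      obtain ⟨x, hx, hle⟩ := h' (∑ i, b i • (i : F))
      have h1 := hab x hx _ (single_mem_stdSimplex ℝ (⟨y, hy⟩ : u))
      have h2 : ∑ i, b i * L x i ≤ L x (∑ i, b i • (i : F)) :=
        (hconc x hx).le_map_sum (fun i _ => hb.1 i) hb.2 fun i _ => mem_univ _
      simp only [Pi.single_apply, ite_mul, one_mul, zero_mul, Finset.sum_ite_eq',
        Finset.mem_univ, if_true] at h1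
      exact h1.trans (h2.trans hle)
  obtain ⟨x, hx, hxW⟩ := key
  exact ⟨x, hx, fun y => mem_iInter.1 hxW y⟩

noncomputable section

/-! ### Square-integrable functions on the unit interval -/

/-- Lebesgue measure on the unit interval. -/
abbrev unitVolume : Measure ℝ := volume.restrict (Icc (0 : ℝ) 1)

instance : IsProbabilityMeasure unitVolume := ⟨by simp [unitVolume]⟩

theorem memLp_of_continuous (g : C(ℝ, ℝ)) : MemLp g 2 unitVolume := by
  obtain ⟨C, hC⟩ := (isCompact_Icc (a := (0 : ℝ)) (b := 1)).exists_bound_of_continuousOn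
    g.continuous.continuousOn
  exact MemLp.of_bound g.continuous.aestronglyMeasurable C
    ((ae_restrict_mem measurableSet_Icc).mono hC)

/-- The class in `L²(0, 1)` of a continuous function on the line. -/
def toL2 : C(ℝ, ℝ) →ₗ[ℝ] Lp ℝ 2 unitVolume where
  toFun g := (memLp_of_continuous g).toLp g
  map_add' _ _ := rfl
  map_smul' _ _ := rfl

theorem coeFn_toL2 (g : C(ℝ, ℝ)) : toL2 g =ᵐ[unitVolume] g :=
  MemLp.coeFn_toLp (memLp_of_continuous g)

theorem toL2_mono {g h : C(ℝ, ℝ)} (hgh : ∀ t, g t ≤ h t) : toL2 g ≤ toL2 h := by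
  rw [← Lp.coeFn_le]
  filter_upwards [coeFn_toL2 g, coeFn_toL2 h] with t h1 h2
  rw [h1, h2]
  exact hgh t

theorem inner_toL2 (m : Lp ℝ 2 unitVolume) (g : C(ℝ, ℝ)) :
    inner ℝ m (toL2 g) = ∫ t, m t * g t ∂unitVolume := by
  rw [L2.inner_def]
  refine integral_congr_ae ?_
  filter_upwards [coeFn_toL2 g] with t h1
  rw [h1]
  simp [mul_comm]

theorem ae_nonneg_of_forall_inner_nonneg {m : Lp ℝ 2 unitVolume}
    (h : ∀ g : Lp ℝ 2 unitVolume, 0 ≤ g → 0 ≤ inner ℝ m g) : ∀ᵐ t ∂unitVolume, 0 ≤ m t := by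
  refine ae_nonneg_of_forall_setIntegral_nonneg ((Lp.memLp m).integrable one_le_two)
    fun s hs hfin => ?_
  rw [← L2.inner_indicatorConstLp_one (𝕜 := ℝ) hs hfin.ne, real_inner_comm]
  refine h _ ?_
  rw [← Lp.coeFn_nonneg]
  filter_upwards [indicatorConstLp_coeFn (p := 2) (hs := hs) (hμs := hfin.ne) (c := (1 : ℝ))]
    with t ht
  rw [ht]
  exact indicator_nonneg (fun _ _ => zero_le_one) t

namespace TriSurface

variable (S : TriSurface)

/-! ### Weak compactness of the space of density curves -/

/-- The measurable families `t ↦ μ_t` of probability densities on the surface, represented by the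
functionals `g ↦ ∫ g μ_v` on `L²(0, 1)`. -/
def densityFunctionals : Set (S.V → WeakDual ℝ (Lp ℝ 2 unitVolume)) :=
  {ξ | (∀ v, ∀ g : Lp ℝ 2 unitVolume, 0 ≤ g → 0 ≤ ξ v g) ∧
    ∀ g : Lp ℝ 2 unitVolume, ∑ v, S.dualArea v * ξ v g = inner ℝ (toL2 1) g}

theorem convex_densityFunctionals : Convex ℝ S.densityFunctionals := by
  intro ξ hξ η hη a b ha hb hab
  refine ⟨fun v g hg => add_nonneg (mul_nonneg ha (hξ.1 v g hg)) (mul_nonneg hb (hη.1 v g hg)),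
    fun g => ?_⟩
  have : ∑ v, S.dualArea v * (a • ξ + b • η) v g
      = a * ∑ v, S.dualArea v * ξ v g + b * ∑ v, S.dualArea v * η v g := by
    rw [Finset.mul_sum, Finset.mul_sum, ← Finset.sum_add_distrib]
    refine Finset.sum_congr rfl fun v _ => ?_
    change _ * (a * ξ v g + b * η v g) = _
    ring
  rw [this, hξ.2, hη.2, ← add_mul, hab, one_mul]

theorem densityFunctionals_apply_mono {ξ : S.V → WeakDual ℝ (Lp ℝ 2 unitVolume)}
    (hξ : ξ ∈ S.densityFunctionals) (v : S.V) {g h : Lp ℝ 2 unitVolume} (hgh : g ≤ h) :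
    ξ v g ≤ ξ v h := by
  have := hξ.1 v (h - g) (sub_nonneg.2 hgh)
  rw [map_sub] at this
  linarith

theorem isCompact_densityFunctionals : IsCompact S.densityFunctionals := by
  have hev : ∀ v (g : Lp ℝ 2 unitVolume),
      Continuous fun ξ : S.V → WeakDual ℝ (Lp ℝ 2 unitVolume) => ξ v g := fun v g =>
    (WeakDual.eval_continuous g).comp (continuous_apply v)
  have hclosed : IsClosed S.densityFunctionals := by
    have heq : S.densityFunctionals = (⋂ v, ⋂ g : Lp ℝ 2 unitVolume, ⋂ _ : 0 ≤ g, {ξ | 0 ≤ ξ v g})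
        ∩ ⋂ g : Lp ℝ 2 unitVolume, {ξ | ∑ v, S.dualArea v * ξ v g = inner ℝ (toL2 1) g} := by
      ext ξ
      simp only [densityFunctionals, mem_inter_iff, mem_iInter]
      rfl
    rw [heq]
    refine IsClosed.inter ?_ ?_
    · exact isClosed_iInter fun v => isClosed_iInter fun g => isClosed_iInter fun _ =>
        isClosed_le continuous_const (hev v g)
    · exact isClosed_iInter fun g => isClosed_eq
        (continuous_finsetSum _ fun v _ => continuous_const.mul (hev v g)) continuous_const
  refine (isCompact_univ_pi fun v => WeakDual.isCompact_closedBall (𝕜 := ℝ)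
    (0 : StrongDual ℝ (Lp ℝ 2 unitVolume)) ((S.dualArea v)⁻¹ * ‖toL2 1‖)).of_isClosed_subset
    hclosed fun ξ hξ v _ => ?_
  rw [mem_preimage, mem_closedBall_zero_iff]
  have hv := S.dualArea_pos v
  refine ContinuousLinearMap.opNorm_le_bound _ (by positivity) fun g => ?_
  have h1 : ∀ u, 0 ≤ S.dualArea u * ξ u |g| := fun u =>
    mul_nonneg (S.dualArea_pos u).le (hξ.1 u _ (abs_nonneg g))
  have h2 : S.dualArea v * ξ v |g| ≤ ‖toL2 1‖ * ‖g‖ := by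
    refine (Finset.single_le_sum (f := fun u => S.dualArea u * ξ u |g|) (fun u _ => h1 u)
      (Finset.mem_univ v)).trans ?_
    rw [hξ.2, ← norm_abs_eq_norm g]
    exact real_inner_le_norm _ _
  have h3 : |ξ v g| ≤ ξ v |g| := by
    refine abs_le.2 ⟨?_, S.densityFunctionals_apply_mono hξ v (le_abs_self g)⟩
    have := S.densityFunctionals_apply_mono hξ v (neg_le.1 (neg_le_abs g))
    rwa [map_neg] at this
  have h4 : ξ v |g| ≤ (S.dualArea v)⁻¹ * (‖toL2 1‖ * ‖g‖) := by
    rw [inv_mul_eq_div, le_div_iff₀ hv]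
    linarith
  rw [mul_assoc]
  exact h3.trans h4

/-- The functionals of a continuous family of probability densities. -/
theorem mem_densityFunctionals_of_continuous {m : S.V → C(ℝ, ℝ)} (hm : ∀ v t, 0 ≤ m v t)
    (hsum : ∑ v, S.dualArea v • m v = 1) :
    (fun v => StrongDual.toWeakDual (InnerProductSpace.toDual ℝ _ (toL2 (m v))))
      ∈ S.densityFunctionals := by
  refine ⟨fun v g hg => ?_, fun g => ?_⟩
  · change 0 ≤ inner ℝ (toL2 (m v)) g
    rw [L2.inner_def]
    refine integral_nonneg_of_ae ?_
    rw [← Lp.coeFn_nonneg] at hg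
    filter_upwards [hg, coeFn_toL2 (m v)] with t h1 h2
    rw [h2]
    exact mul_nonneg h1 (hm v t)
  · change ∑ v, S.dualArea v * inner ℝ (toL2 (m v)) g = _
    simp_rw [← hsum, map_sum, map_smul, sum_inner, real_inner_smul_left]

/-- A representative, with values in the probability densities at all times, of the family of
densities defined by functionals. -/
theorem exists_density {μ₀ : S.V → ℝ} (h₀ : μ₀ ∈ S.Prob)
    {ξ : S.V → WeakDual ℝ (Lp ℝ 2 unitVolume)} (hξ : ξ ∈ S.densityFunctionals) :
    ∃ μ : ℝ → S.V → ℝ, (∀ t, μ t ∈ S.Prob) ∧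
      (∀ v, AEStronglyMeasurable (fun t => μ t v) unitVolume) ∧
      ∀ v (g : C(ℝ, ℝ)), ξ v (toL2 g) = ∫ t, μ t v * g t ∂unitVolume := by
  classical
  let m : S.V → Lp ℝ 2 unitVolume := fun v =>
    (InnerProductSpace.toDual ℝ _).symm (WeakDual.toStrongDual (ξ v))
  have hm : ∀ v g, inner ℝ (m v) g = ξ v g := fun v g => InnerProductSpace.toDual_symm_apply
  have hnn : ∀ᵐ t ∂unitVolume, ∀ v, 0 ≤ m v t := ae_all_iff.2 fun v =>
    ae_nonneg_of_forall_inner_nonneg fun g hg => by rw [hm]; exact hξ.1 v g hg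
  have hsum : ∑ v, S.dualArea v • m v = toL2 1 := by
    refine ext_inner_right ℝ fun g => ?_
    rw [← hξ.2, sum_inner]
    simp_rw [real_inner_smul_left, hm]
  have hone : ∀ᵐ t ∂unitVolume, ∑ v, S.dualArea v * m v t = 1 := by
    have h1 : ∀ᵐ t ∂unitVolume, ∀ v, (S.dualArea v • m v) t = S.dualArea v * m v t :=
      ae_all_iff.2 fun v => Lp.coeFn_smul (S.dualArea v) (m v)
    filter_upwards [coeFn_toL2 1, h1,
      Lp.coeFn_finsetSum Finset.univ fun v => S.dualArea v • m v] with t h2 h1 h3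
    rw [hsum, h2] at h3
    simp only [Finset.sum_apply, h1] at h3
    exact h3.symm
  have hae : ∀ᵐ t ∂unitVolume, (fun v => m v t) ∈ S.Prob := by
    filter_upwards [hnn, hone] with t h1 h2 using ⟨h1, h2⟩
  let μ : ℝ → S.V → ℝ := fun t => if (fun v => m v t) ∈ S.Prob then fun v => m v t else μ₀
  have hμ : ∀ v, (fun t => m v t) =ᵐ[unitVolume] fun t => μ t v := fun v => by
    filter_upwards [hae] with t ht
    simp only [μ, if_pos ht]
  refine ⟨μ, fun t => ?_, fun v => (Lp.aestronglyMeasurable (m v)).congr (hμ v), fun v g => ?_⟩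
  · simp only [μ]
    split_ifs with h
    exacts [h, h₀]
  · rw [← hm, inner_toL2]
    refine integral_congr_ae ?_
    filter_upwards [hμ v] with t ht
    rw [ht]

end TriSurface

end

noncomputable section

namespace TriSurface

variable (S : TriSurface)

/-! ### The Lagrangian -/

/-- The potentials that are continuously differentiable in time. -/
def smoothPotentials : Submodule ℝ (ℝ → S.V → ℝ) where
  carrier := {φ | ∀ v, ContDiff ℝ 1 fun t => φ t v}
  add_mem' h h' v := (h v).add (h' v)
  zero_mem' _ := contDiff_const
  smul_mem' c _ h v := (h v).const_smul c

variable {S}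

theorem contDiff_potential (φ : S.smoothPotentials) : ∀ v, ContDiff ℝ 1 fun t => φ.1 t v := φ.2

theorem continuous_potential (φ : S.smoothPotentials) : Continuous φ.1 :=
  continuous_pi fun v => (contDiff_potential φ v).continuous

theorem continuous_deriv_potential (φ : S.smoothPotentials) (v : S.V) :
    Continuous (deriv fun s => φ.1 s v) :=
  (contDiff_potential φ v).continuous_deriv le_rfl

theorem hasDerivAt_potential (φ : S.smoothPotentials) (v : S.V) (t : ℝ) :
    HasDerivAt (fun s => φ.1 s v) (deriv (fun s => φ.1 s v) t) t :=
  ((contDiff_potential φ v).differentiable one_ne_zero t).hasDerivAt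

theorem deriv_add_potential (φ ψ : S.smoothPotentials) (v : S.V) (t : ℝ) :
    deriv (fun s => (φ + ψ).1 s v) t
      = deriv (fun s => φ.1 s v) t + deriv (fun s => ψ.1 s v) t :=
  ((hasDerivAt_potential φ v t).add (hasDerivAt_potential ψ v t)).deriv

theorem deriv_smul_potential (c : ℝ) (φ : S.smoothPotentials) (v : S.V) (t : ℝ) :
    deriv (fun s => (c • φ).1 s v) t = c * deriv (fun s => φ.1 s v) t :=
  ((hasDerivAt_potential φ v t).const_mul c).deriv

/-- The left-hand side `∂ₜφ_v + ½ (∑_{f ∈ T_v} |f| ‖(Gφ)_f‖²) / (3|v|)` of the discrete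
Hamilton-Jacobi inequality. -/
def hamiltonJacobi (φ : S.smoothPotentials) (v : S.V) : C(ℝ, ℝ) where
  toFun t := deriv (fun s => φ.1 s v) t
    + (1 / 2) * S.vertexMean (fun f => ‖S.gradAt (φ.1 t) f‖ ^ 2) v
  continuous_toFun := by
    refine (continuous_deriv_potential φ v).add (continuous_const.mul ?_)
    refine (continuous_finsetSum _ fun f _ => continuous_const.mul ?_).div_const _
    exact (((S.continuous_gradAt f).comp (continuous_potential φ)).norm).pow 2

theorem hamiltonJacobi_convex (φ ψ : S.smoothPotentials) {a b : ℝ} (ha : 0 ≤ a) (hb : 0 ≤ b)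
    (hab : a + b = 1) (v : S.V) (t : ℝ) :
    hamiltonJacobi (a • φ + b • ψ) v t
      ≤ (a • hamiltonJacobi φ v + b • hamiltonJacobi ψ v) t := by
  change deriv (fun s => (a • φ + b • ψ).1 s v) t
      + (1 / 2) * S.vertexMean (fun f => ‖S.gradAt (a • φ.1 t + b • ψ.1 t) f‖ ^ 2) v
    ≤ a * (deriv (fun s => φ.1 s v) t
        + (1 / 2) * S.vertexMean (fun f => ‖S.gradAt (φ.1 t) f‖ ^ 2) v)
      + b * (deriv (fun s => ψ.1 s v) t
        + (1 / 2) * S.vertexMean (fun f => ‖S.gradAt (ψ.1 t) f‖ ^ 2) v)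
  rw [deriv_add_potential, deriv_smul_potential, deriv_smul_potential]
  have h1 : S.vertexMean (fun f => ‖S.gradAt (a • φ.1 t + b • ψ.1 t) f‖ ^ 2) v
      ≤ a * S.vertexMean (fun f => ‖S.gradAt (φ.1 t) f‖ ^ 2) v
        + b * S.vertexMean (fun f => ‖S.gradAt (ψ.1 t) f‖ ^ 2) v := by
    simp only [vertexMean]
    rw [mul_div_assoc', mul_div_assoc', ← add_div]
    refine div_le_div_of_nonneg_right ?_ (by linarith [S.dualArea_pos v])
    rw [Finset.mul_sum, Finset.mul_sum, ← Finset.sum_add_distrib]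
    refine Finset.sum_le_sum fun f _ => ?_
    have h2 : ‖S.gradAt (a • φ.1 t + b • ψ.1 t) f‖ ^ 2
        ≤ a * ‖S.gradAt (φ.1 t) f‖ ^ 2 + b * ‖S.gradAt (ψ.1 t) f‖ ^ 2 := by
      rw [gradAt_add, gradAt_smul, gradAt_smul]
      have h3 : ‖a • S.gradAt (φ.1 t) f + b • S.gradAt (ψ.1 t) f‖
          ≤ a * ‖S.gradAt (φ.1 t) f‖ + b * ‖S.gradAt (ψ.1 t) f‖ := by
        refine (norm_add_le _ _).trans ?_
        rw [norm_smul, norm_smul, Real.norm_of_nonneg ha, Real.norm_of_nonneg hb]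
      refine (pow_le_pow_left₀ (norm_nonneg _) h3 2).trans ?_
      exact (convexOn_pow 2).2 (norm_nonneg _) (norm_nonneg _) ha hb hab
    nlinarith [mul_le_mul_of_nonneg_left h2 (S.area_pos f).le]
  linarith

variable (S) in
/-- The Lagrangian of the dual problem: affine in the density functionals, concave in the
potential. -/
def lagrangian (μ₀ μ₁ : S.V → ℝ) (ξ : S.V → WeakDual ℝ (Lp ℝ 2 unitVolume))
    (φ : S.smoothPotentials) : ℝ :=
  S.pair (φ.1 1) μ₁ - S.pair (φ.1 0) μ₀ - ∑ v, S.dualArea v * ξ v (toL2 (hamiltonJacobi φ v))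

/-- Subtracting from the potential the time integral of an upper bound of the Hamilton-Jacobi
expression, which is constant in space, produces a subsolution. -/
theorem isSubsolution_sub_integral (φ : S.smoothPotentials) (M : C(ℝ, ℝ))
    (hM : ∀ v t, hamiltonJacobi φ v t ≤ M t) :
    S.IsSubsolution fun t v => φ.1 t v - ∫ s in (0 : ℝ)..t, M s := by
  have hd : ∀ t v, HasDerivAt (fun t => φ.1 t v - ∫ s in (0 : ℝ)..t, M s)
      (deriv (fun s => φ.1 s v) t - M t) t := fun t v =>
    (hasDerivAt_potential φ v t).sub (intervalIntegral.integral_hasDerivAt_right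
      (M.continuous.intervalIntegrable _ _)
      M.continuous.stronglyMeasurable.stronglyMeasurableAtFilter
      M.continuous.continuousAt)
  refine ⟨fun v t _ => (hd t v).differentiableAt.differentiableWithinAt, fun t ht v => ?_⟩
  rw [(hd t v).hasDerivWithinAt.derivWithin (uniqueDiffOn_Icc zero_lt_one t ht)]
  have h1 : ∀ f, S.gradAt (fun v => φ.1 t v - ∫ s in (0 : ℝ)..t, M s) f = S.gradAt (φ.1 t) f :=
    fun f => S.gradAt_congr_sub_const (fun v => rfl) f
  simp only [h1]
  have := hM v t
  change _ + 1 / 2 * S.vertexMean (fun f => ‖S.gradAt (φ.1 t) f‖ ^ 2) v ≤ M t at this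
  unfold vertexMean at this
  linarith

theorem pair_sub_const {μ : S.V → ℝ} (hμ : μ ∈ S.Prob) (ψ : S.V → ℝ) (c : ℝ) :
    ∑ v, S.dualArea v * (ψ v - c) * μ v = S.pair ψ μ - c := by
  have h1 : c = ∑ v, c * (S.dualArea v * μ v) := by rw [← Finset.mul_sum, hμ.2, mul_one]
  conv_rhs => rw [h1]
  rw [pair, ← Finset.sum_sub_distrib]
  exact Finset.sum_congr rfl fun v _ => by ring

/-- For a fixed potential, the Lagrangian is minimized by concentrating the mass at the vertices
where the Hamilton-Jacobi expression is almost maximal; the weights are chosen continuous in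
time. -/
theorem exists_lagrangian_le {μ₀ μ₁ : S.V → ℝ} (h₀ : μ₀ ∈ S.Prob) (h₁ : μ₁ ∈ S.Prob) {W : ℝ}
    (hW : S.wassersteinSq μ₀ μ₁ ≤ (W : EReal)) (φ : S.smoothPotentials) {ε : ℝ} (hε : 0 < ε) :
    ∃ ξ ∈ S.densityFunctionals, S.lagrangian μ₀ μ₁ ξ φ ≤ W + ε := by
  have hne : (Finset.univ : Finset S.V).Nonempty := by
    rw [Finset.nonempty_iff_ne_empty]
    intro h
    have := h₀.2
    rw [h, Finset.sum_empty] at this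
    exact zero_ne_one this
  let h := hamiltonJacobi φ
  let M : C(ℝ, ℝ) := ⟨fun t => Finset.univ.sup' hne fun v => h v t,
    Continuous.finset_sup'_apply hne fun v _ => (h v).continuous⟩
  have hM : ∀ v t, h v t ≤ M t := fun v t =>
    Finset.le_sup' (fun v => h v t) (Finset.mem_univ v)
  have hMeq : ∀ t, ∃ v, h v t = M t := fun t => by
    obtain ⟨v, -, hv⟩ := Finset.exists_mem_eq_sup' hne fun v => h v t
    exact ⟨v, hv.symm⟩
  have hsub := isSubsolution_sub_integral φ M hM
  have hval : S.pair (φ.1 1) μ₁ - S.pair (φ.1 0) μ₀ - ∫ s in (0 : ℝ)..1, M s ≤ W := by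
    have h1 := (le_iSup₂ (f := fun (φ : ℝ → S.V → ℝ) (_ : S.IsSubsolution φ) =>
      ((∑ v, S.dualArea v * φ 1 v * μ₁ v - ∑ v, S.dualArea v * φ 0 v * μ₀ v : ℝ) : EReal))
      _ hsub).trans hW
    have h2 := EReal.coe_le_coe_iff.1 h1
    rw [pair_sub_const h₁, pair_sub_const h₀, intervalIntegral.integral_same] at h2
    linarith
  -- the weights are proportional to `p`, which vanishes where `h < M - ε`
  let p : S.V → ℝ → ℝ := fun v t => max (h v t - M t + ε) 0
  have hpnn : ∀ v t, 0 ≤ p v t := fun v t => le_max_right _ _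
  have hPpos : ∀ t, 0 < ∑ v, p v t := fun t => by
    obtain ⟨v, hv⟩ := hMeq t
    refine Finset.sum_pos' (fun v _ => hpnn v t) ⟨v, Finset.mem_univ v, ?_⟩
    exact lt_of_lt_of_le (by rw [hv]; linarith) (le_max_left _ _)
  have hpc : ∀ v, Continuous (p v) := fun v =>
    ((((h v).continuous.sub M.continuous).add continuous_const).max continuous_const)
  let m : S.V → C(ℝ, ℝ) := fun v =>
    ⟨fun t => (S.dualArea v)⁻¹ * (p v t / ∑ u, p u t),
      continuous_const.mul ((hpc v).div (continuous_finsetSum _ fun u _ => hpc u)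
        fun t => (hPpos t).ne')⟩
  have hmul : ∀ v t, S.dualArea v * m v t = p v t / ∑ u, p u t := fun v t =>
    mul_inv_cancel_left₀ (S.dualArea_pos v).ne' _
  have hmem := S.mem_densityFunctionals_of_continuous (m := m)
    (fun v t => mul_nonneg (inv_nonneg.2 (S.dualArea_pos v).le)
      (div_nonneg (hpnn v t) (hPpos t).le)) (by
      ext t
      simp only [ContinuousMap.coe_sum, ContinuousMap.coe_smul, Finset.sum_apply, Pi.smul_apply,
        smul_eq_mul, hmul, ContinuousMap.one_apply]
      rw [← Finset.sum_div, div_self (hPpos t).ne'])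
  refine ⟨_, hmem, ?_⟩
  have hint : ∀ v, Continuous fun t => S.dualArea v * (m v t * h v t) := fun v =>
    continuous_const.mul ((m v).continuous.mul (h v).continuous)
  have hlow : (∫ s in (0 : ℝ)..1, M s) - ε
      ≤ ∑ v, S.dualArea v * inner ℝ (toL2 (m v)) (toL2 (h v)) := by
    have h1 : ∀ v, S.dualArea v * inner ℝ (toL2 (m v)) (toL2 (h v))
        = ∫ t in (0 : ℝ)..1, S.dualArea v * (m v t * h v t) := fun v => by
      rw [intervalIntegral.integral_const_mul, inner_toL2,
        intervalIntegral.integral_of_le zero_le_one, ← integral_Icc_eq_integral_Ioc]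
      congr 1
      refine integral_congr_ae ?_
      filter_upwards [coeFn_toL2 (m v)] with t ht
      rw [ht]
    simp_rw [h1]
    rw [← intervalIntegral.integral_finsetSum fun v _ =>
      (hint v).intervalIntegrable _ _]
    have h2 : (∫ s in (0 : ℝ)..1, M s) - ε = ∫ s in (0 : ℝ)..1, (M s - ε) := by
      rw [intervalIntegral.integral_sub (M.continuous.intervalIntegrable _ _) (by simp)]
      simp
    rw [h2]
    refine intervalIntegral.integral_mono_on zero_le_one
      ((M.continuous.sub continuous_const).intervalIntegrable _ _)
      ((continuous_finsetSum _ fun v _ => hint v).intervalIntegrable _ _)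
      fun t _ => ?_
    have h3 : M t - ε = ∑ v, p v t / (∑ u, p u t) * (M t - ε) := by
      rw [← Finset.sum_mul, ← Finset.sum_div, div_self (hPpos t).ne', one_mul]
    rw [h3]
    refine Finset.sum_le_sum fun v _ => ?_
    rw [← mul_assoc, hmul, div_mul_eq_mul_div, div_mul_eq_mul_div]
    refine div_le_div_of_nonneg_right ?_ (hPpos t).le
    rcases le_total (h v t - M t + ε) 0 with hle | hle
    · simp [p, max_eq_right hle]
    · exact mul_le_mul_of_nonneg_left (by linarith) (hpnn v t)
  change S.pair (φ.1 1) μ₁ - S.pair (φ.1 0) μ₀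
    - ∑ v, S.dualArea v * inner ℝ (toL2 (m v)) (toL2 (h v)) ≤ W + ε
  linarith

/-- Strong duality, in weak form: a bound of the supremum of the dual problem is witnessed by one
family of densities that satisfies the optimality inequality against all potentials. -/
theorem exists_density_of_wassersteinSq_le {μ₀ μ₁ : S.V → ℝ} (h₀ : μ₀ ∈ S.Prob) (h₁ : μ₁ ∈ S.Prob)
    {W : ℝ} (hW : S.wassersteinSq μ₀ μ₁ ≤ (W : EReal)) :
    ∃ μ : ℝ → S.V → ℝ, (∀ t, μ t ∈ S.Prob) ∧
      (∀ v, AEStronglyMeasurable (fun t => μ t v) unitVolume) ∧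
      ∀ φ : S.smoothPotentials, S.pair (φ.1 1) μ₁ - S.pair (φ.1 0) μ₀
        - ∫ t, (S.pair (fun v => deriv (fun s => φ.1 s v) t) (μ t)
          + (1 / 2) * S.dirichlet (μ t) (φ.1 t)) ∂unitVolume ≤ W := by
  have hlin : ∀ (ξ η : S.V → WeakDual ℝ (Lp ℝ 2 unitVolume)) (a b : ℝ), a + b = 1 → ∀ φ,
      S.lagrangian μ₀ μ₁ (a • ξ + b • η) φ
        = a * S.lagrangian μ₀ μ₁ ξ φ + b * S.lagrangian μ₀ μ₁ η φ := by
    intro ξ η a b hab φ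
    have h1 : ∑ v, S.dualArea v * (a • ξ + b • η) v (toL2 (hamiltonJacobi φ v))
        = a * ∑ v, S.dualArea v * ξ v (toL2 (hamiltonJacobi φ v))
          + b * ∑ v, S.dualArea v * η v (toL2 (hamiltonJacobi φ v)) := by
      rw [Finset.mul_sum, Finset.mul_sum, ← Finset.sum_add_distrib]
      refine Finset.sum_congr rfl fun v _ => ?_
      change _ * (a * ξ v _ + b * η v _) = _
      ring
    simp only [lagrangian, h1]
    obtain rfl : b = 1 - a := by linarith
    ring
  obtain ⟨ξ, hξ, hle⟩ := exists_forall_le_of_forall_exists_le (W := W)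
    S.isCompact_densityFunctionals S.convex_densityFunctionals
    (let ⟨ξ, hξ, _⟩ := exists_lagrangian_le h₀ h₁ hW 0 one_pos; ⟨ξ, hξ⟩)
    (L := S.lagrangian μ₀ μ₁)
    (fun φ => continuous_const.sub (continuous_finsetSum _ fun v _ => continuous_const.mul
      ((WeakDual.eval_continuous _).comp (continuous_apply v))))
    (fun φ => ⟨S.convex_densityFunctionals, fun ξ _ η _ a b _ _ hab => (hlin ξ η a b hab φ).le⟩)
    (fun ξ hξ => ⟨convex_univ, fun φ _ ψ _ a b ha hb hab => by
      have h1 : ∑ v, S.dualArea v * ξ v (toL2 (hamiltonJacobi (a • φ + b • ψ) v))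
          ≤ a * ∑ v, S.dualArea v * ξ v (toL2 (hamiltonJacobi φ v))
            + b * ∑ v, S.dualArea v * ξ v (toL2 (hamiltonJacobi ψ v)) := by
        rw [Finset.mul_sum, Finset.mul_sum, ← Finset.sum_add_distrib]
        refine Finset.sum_le_sum fun v _ => ?_
        have h2 := S.densityFunctionals_apply_mono hξ v
          (toL2_mono (hamiltonJacobi_convex φ ψ ha hb hab v))
        rw [map_add, map_smul, map_smul, map_add, map_smul, map_smul, smul_eq_mul,
          smul_eq_mul] at h2
        linarith [mul_le_mul_of_nonneg_left h2 (S.dualArea_pos v).le]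
      have h3 : ∀ t (μ : S.V → ℝ), S.pair ((a • φ + b • ψ).1 t) μ
          = a * S.pair (φ.1 t) μ + b * S.pair (ψ.1 t) μ := fun t μ => by
        change S.pair (a • φ.1 t + b • ψ.1 t) μ = _
        rw [pair_add_left, pair_smul_left, pair_smul_left]
      simp only [lagrangian, h3, smul_eq_mul]
      linarith⟩)
    (fun φ ε hε => exists_lagrangian_le h₀ h₁ hW φ hε)
  obtain ⟨μ, hμ, hmeas, hrep⟩ := S.exists_density h₀ hξ
  refine ⟨μ, hμ, hmeas, fun φ => ?_⟩
  have hint : ∀ v, Integrable (fun t => S.dualArea v * (μ t v * hamiltonJacobi φ v t)) unitVolume :=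
    fun v => by
      refine Integrable.const_mul ?_ _
      refine ((memLp_of_continuous (hamiltonJacobi φ v)).integrable one_le_two).bdd_mul
        (c := (S.dualArea v)⁻¹) (hmeas v) (.of_forall fun t => ?_)
      rw [Real.norm_of_nonneg ((hμ t).1 v)]
      exact Prob.le_inv S (hμ t) v
  have h1 : ∫ t, (S.pair (fun v => deriv (fun s => φ.1 s v) t) (μ t)
          + (1 / 2) * S.dirichlet (μ t) (φ.1 t)) ∂unitVolume
      = ∑ v, S.dualArea v * ξ v (toL2 (hamiltonJacobi φ v)) := by
    simp_rw [hrep, ← integral_const_mul]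
    rw [← integral_finsetSum _ fun v _ => hint v]
    refine integral_congr_ae (.of_forall fun t => ?_)
    simp only
    rw [← S.sum_vertexMean_sq, pair, Finset.mul_sum, ← Finset.sum_add_distrib]
    refine Finset.sum_congr rfl fun v _ => ?_
    change _ = S.dualArea v * (μ t v * (deriv (fun s => φ.1 s v) t
      + (1 / 2) * S.vertexMean (fun f => ‖S.gradAt (φ.1 t) f‖ ^ 2) v))
    ring
  rw [h1]
  exact hle φ

end TriSurface

end

noncomputable section

/-! ### Primitives from a weak equation -/

/-- A function on the unit interval that has an integrable weak derivative, with prescribed boundary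
values, is a primitive almost everywhere (du Bois-Reymond). -/
theorem ae_eq_primitive_of_weak_deriv {a h : ℝ → ℝ} {a₀ a₁ : ℝ} (ha : Integrable a unitVolume)
    (hh : Integrable h unitVolume)
    (hweak : ∀ η : ℝ → ℝ, ContDiff ℝ 1 η → η 1 * a₁ - η 0 * a₀ - ∫ t, deriv η t * a t ∂unitVolume
      = ∫ t, η t * h t ∂unitVolume) :
    (∀ᵐ t ∂unitVolume, a t = a₀ + ∫ s in (0 : ℝ)..t, h s) ∧
      a₀ + ∫ s in (0 : ℝ)..1, h s = a₁ := by
  have hset : ∀ f : ℝ → ℝ, ∫ t, f t ∂unitVolume = ∫ t in (0 : ℝ)..1, f t := fun f => by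
    rw [intervalIntegral.integral_of_le zero_le_one, ← integral_Icc_eq_integral_Ioc]
  have hhi : IntervalIntegrable h volume 0 1 :=
    (intervalIntegrable_iff_integrableOn_Icc_of_le zero_le_one).2 hh
  have hend : a₀ + ∫ s in (0 : ℝ)..1, h s = a₁ := by
    have := hweak (fun _ => 1) contDiff_const
    simp only [deriv_const, zero_mul, integral_zero, one_mul] at this
    rw [hset] at this
    linarith
  refine ⟨?_, hend⟩
  set b : ℝ → ℝ := fun t => a₀ + ∫ s in (0 : ℝ)..t, h s with hb
  have hbac : AbsolutelyContinuousOnInterval b 0 1 :=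
    (AbsolutelyContinuousOnInterval.const a₀ 0 1).fun_add
      (hhi.absolutelyContinuousOnInterval_intervalIntegral (by simp))
  have hbd : ∀ᵐ t ∂unitVolume, deriv b t = h t := by
    rw [ae_restrict_iff' measurableSet_Icc]
    filter_upwards [hhi.ae_hasDerivAt_integral] with t ht htI
    rw [uIcc_of_le zero_le_one] at ht
    exact ((ht htI 0 (by simp)).const_add a₀).deriv
  have hbint : Integrable b unitVolume := by
    have := hbac.continuousOn
    rw [uIcc_of_le zero_le_one] at this
    exact this.integrableOn_Icc
  have hzero : ∀ η : ℝ → ℝ, ContDiff ℝ 1 η → ∫ t, deriv η t * (a t - b t) ∂unitVolume = 0 := by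
    intro η hη
    have hηac : AbsolutelyContinuousOnInterval η 0 1 :=
      ContDiffOn.absolutelyContinuousOnInterval hη.contDiffOn
    have h1 := hηac.integral_mul_deriv_eq_deriv_mul hbac
    have h2 : ∫ t in (0 : ℝ)..1, η t * deriv b t = ∫ t, η t * h t ∂unitVolume := by
      rw [← hset]
      refine integral_congr_ae ?_
      filter_upwards [hbd] with t ht
      rw [ht]
    have h3 : b 1 = a₁ := hend
    have h4 : b 0 = a₀ := by simp [hb]
    rw [h2, h3, h4, ← hset] at h1
    have hmul : ∀ {f : ℝ → ℝ}, Integrable f unitVolume →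
        Integrable (fun t => deriv η t * f t) unitVolume := fun hf => by
      have hc := hη.continuous_deriv le_rfl
      obtain ⟨C, hC⟩ := (isCompact_Icc (a := (0 : ℝ)) (b := 1)).exists_bound_of_continuousOn
        hc.continuousOn
      exact hf.bdd_mul (c := C) hc.aestronglyMeasurable
        ((ae_restrict_mem measurableSet_Icc).mono hC)
    simp_rw [mul_sub]
    rw [integral_sub (hmul ha) (hmul hbint)]
    have := hweak η hη
    linarith
  have hsub : IntegrableOn (fun t => a t - b t) (Icc 0 1) := ha.sub hbint
  have hae : ∀ᵐ t, t ∈ Ioo (0 : ℝ) 1 → a t - b t = 0 := by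
    refine isOpen_Ioo.ae_eq_zero_of_integral_contDiff_smul_eq_zero
      (hsub.mono_set Ioo_subset_Icc_self).locallyIntegrableOn fun g hg _ hgs => ?_
    have h1 : ∀ t, HasDerivAt (fun t => ∫ s in (0 : ℝ)..t, g s) (g t) t := fun t =>
      intervalIntegral.integral_hasDerivAt_right (hg.continuous.intervalIntegrable _ _)
        hg.continuous.stronglyMeasurable.stronglyMeasurableAtFilter hg.continuous.continuousAt
    have h2 : deriv (fun t => ∫ s in (0 : ℝ)..t, g s) = g := funext fun t => (h1 t).deriv
    have h3 := hzero (fun t => ∫ s in (0 : ℝ)..t, g s)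
      (contDiff_one_iff_deriv.2 ⟨fun t => (h1 t).differentiableAt, by rw [h2]; exact hg.continuous⟩)
    rw [h2] at h3
    rw [← h3]
    refine (setIntegral_eq_integral_of_forall_compl_eq_zero fun t ht => ?_).symm
    rw [image_eq_zero_of_notMem_tsupport fun h => ht (Ioo_subset_Icc_self (hgs h)), zero_smul]
  rw [← ae_restrict_iff' measurableSet_Ioo, restrict_Ioo_eq_restrict_Icc] at hae
  filter_upwards [hae] with t ht
  linarith

namespace TriSurface

variable {S : TriSurface}

/-! ### The optimal velocity field -/

/-- The weight `√(|f| μ̂_f)`, so that `√(|f| μ̂_f) G` has the Dirichlet energy as its squared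
norm. -/
def rootWeight (μ : S.V → ℝ) (f : S.T) : ℝ := Real.sqrt (S.area f * S.avg μ f)

theorem rootWeight_sq {μ : S.V → ℝ} (hμ : ∀ v, 0 ≤ μ v) (f : S.T) :
    rootWeight μ f ^ 2 = S.area f * S.avg μ f :=
  Real.sq_sqrt (mul_nonneg (S.area_pos f).le (S.avg_nonneg hμ f))

theorem continuous_rootWeight (f : S.T) : Continuous fun μ : S.V → ℝ => rootWeight μ f := by
  unfold rootWeight avg
  fun_prop

theorem aestronglyMeasurable_rootWeight {μ : ℝ → S.V → ℝ}
    (hmeas : ∀ v, AEStronglyMeasurable (fun t => μ t v) unitVolume) (f : S.T) :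
    AEStronglyMeasurable (fun t => rootWeight (μ t) f) unitVolume :=
  (continuous_rootWeight f).comp_aestronglyMeasurable
    (aemeasurable_pi_iff.2 fun v => (hmeas v).aemeasurable).aestronglyMeasurable

theorem exists_rootWeight_le (f : S.T) : ∃ C, ∀ μ ∈ S.Prob, ‖rootWeight μ f‖ ≤ C := by
  refine ⟨rootWeight (fun v => (S.dualArea v)⁻¹) f, fun μ hμ => ?_⟩
  rw [Real.norm_of_nonneg (show 0 ≤ rootWeight μ f from Real.sqrt_nonneg _)]
  exact Real.sqrt_le_sqrt (mul_le_mul_of_nonneg_left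
    (S.avg_mono (fun v => Prob.le_inv S hμ v) f) (S.area_pos f).le)

theorem memLp_rootWeight_smul_gradAt {μ : ℝ → S.V → ℝ} (hμ : ∀ t, μ t ∈ S.Prob)
    (hmeas : ∀ v, AEStronglyMeasurable (fun t => μ t v) unitVolume) {φ : ℝ → S.V → ℝ}
    (hφ : Continuous φ) (f : S.T) :
    MemLp (fun t => rootWeight (μ t) f • S.gradAt (φ t) f) 2 unitVolume := by
  have hc : Continuous fun t => S.gradAt (φ t) f := (S.continuous_gradAt f).comp hφ
  obtain ⟨C, hC⟩ := exists_rootWeight_le f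
  obtain ⟨D, hD⟩ := (isCompact_Icc (a := (0 : ℝ)) (b := 1)).exists_bound_of_continuousOn
    hc.continuousOn
  refine MemLp.of_bound ((aestronglyMeasurable_rootWeight hmeas f).smul hc.aestronglyMeasurable)
    (C * D) ((ae_restrict_mem measurableSet_Icc).mono fun t ht => ?_)
  rw [norm_smul]
  exact mul_le_mul (hC _ (hμ t)) (hD t ht) (norm_nonneg _) ((norm_nonneg _).trans (hC _ (hμ t)))

/-- The gradient of a time-dependent potential, weighted by `√(|f| μ̂_f)`, as an element of the
Hilbert space of square-integrable fields of vectors on the triangles. -/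
def weightedGradL2 {μ : ℝ → S.V → ℝ} (hμ : ∀ t, μ t ∈ S.Prob)
    (hmeas : ∀ v, AEStronglyMeasurable (fun t => μ t v) unitVolume) :
    S.smoothPotentials →ₗ[ℝ] PiLp 2 fun _ : S.T => Lp (EuclideanSpace ℝ (Fin 3)) 2 unitVolume where
  toFun φ := WithLp.toLp 2 fun f =>
    (memLp_rootWeight_smul_gradAt hμ hmeas (continuous_potential φ) f).toLp _
  map_add' φ ψ := by
    ext1 f
    have h1 := memLp_rootWeight_smul_gradAt hμ hmeas (continuous_potential φ) f
    have h2 := memLp_rootWeight_smul_gradAt hμ hmeas (continuous_potential ψ) f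
    have h3 := memLp_rootWeight_smul_gradAt hμ hmeas (continuous_potential (φ + ψ)) f
    refine (MemLp.toLp_congr h3 (h1.add h2) (.of_forall fun t => ?_)).trans (MemLp.toLp_add h1 h2)
    change rootWeight (μ t) f • S.gradAt (φ.1 t + ψ.1 t) f
      = rootWeight (μ t) f • S.gradAt (φ.1 t) f + rootWeight (μ t) f • S.gradAt (ψ.1 t) f
    rw [gradAt_add, smul_add]
  map_smul' c φ := by
    ext1 f
    have h1 := memLp_rootWeight_smul_gradAt hμ hmeas (continuous_potential φ) f
    have h2 := memLp_rootWeight_smul_gradAt hμ hmeas (continuous_potential (c • φ)) f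
    refine (MemLp.toLp_congr h2 (h1.const_smul c) (.of_forall fun t => ?_)).trans
      (MemLp.toLp_const_smul c h1)
    change rootWeight (μ t) f • S.gradAt (c • φ.1 t) f
      = c • (rootWeight (μ t) f • S.gradAt (φ.1 t) f)
    rw [gradAt_smul, smul_comm]

theorem inner_weightedGradL2 {μ : ℝ → S.V → ℝ} (hμ : ∀ t, μ t ∈ S.Prob)
    (hmeas : ∀ v, AEStronglyMeasurable (fun t => μ t v) unitVolume)
    (u : PiLp 2 fun _ : S.T => Lp (EuclideanSpace ℝ (Fin 3)) 2 unitVolume)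
    (φ : S.smoothPotentials) :
    inner ℝ u (weightedGradL2 hμ hmeas φ)
      = ∑ f, ∫ t, rootWeight (μ t) f * inner ℝ (u f t) (S.gradAt (φ.1 t) f) ∂unitVolume := by
  rw [PiLp.inner_apply]
  refine Finset.sum_congr rfl fun f _ => ?_
  rw [L2.inner_def]
  refine integral_congr_ae ?_
  filter_upwards [(memLp_rootWeight_smul_gradAt hμ hmeas (continuous_potential φ) f).coeFn_toLp]
    with t ht
  change inner ℝ (u f t) (MemLp.toLp _ (memLp_rootWeight_smul_gradAt hμ hmeas
    (continuous_potential φ) f) t) = _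
  rw [ht, inner_smul_right]

theorem norm_weightedGradL2_sq {μ : ℝ → S.V → ℝ} (hμ : ∀ t, μ t ∈ S.Prob)
    (hmeas : ∀ v, AEStronglyMeasurable (fun t => μ t v) unitVolume) (φ : S.smoothPotentials) :
    ‖weightedGradL2 hμ hmeas φ‖ ^ 2 = ∫ t, S.dirichlet (μ t) (φ.1 t) ∂unitVolume := by
  have hmem := memLp_rootWeight_smul_gradAt hμ hmeas (continuous_potential φ)
  rw [PiLp.norm_sq_eq_of_L2]
  have hsq : ∀ (f : S.T) t, ‖rootWeight (μ t) f • S.gradAt (φ.1 t) f‖ ^ 2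
      = S.area f * S.avg (μ t) f * ‖S.gradAt (φ.1 t) f‖ ^ 2 := fun f t => by
    rw [norm_smul, mul_pow, Real.norm_eq_abs, sq_abs, rootWeight_sq (hμ t).1]
  simp only [dirichlet, ← hsq]
  rw [integral_finsetSum _ fun f _ => (hmem f).integrable_norm_pow two_ne_zero]
  refine Finset.sum_congr rfl fun f _ => ?_
  change ‖MemLp.toLp _ (hmem f)‖ ^ 2 = _
  rw [← real_inner_self_eq_norm_sq, L2.inner_def]
  refine integral_congr_ae ?_
  filter_upwards [(hmem f).coeFn_toLp] with t ht
  rw [ht, real_inner_self_eq_norm_sq]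

theorem integrable_pair_mul {μ : ℝ → S.V → ℝ} (hμ : ∀ t, μ t ∈ S.Prob)
    (hmeas : ∀ v, AEStronglyMeasurable (fun t => μ t v) unitVolume) {g : ℝ → ℝ} (hg : Continuous g)
    (v : S.V) : Integrable (fun t => S.dualArea v * g t * μ t v) unitVolume := by
  refine Integrable.mul_bdd (c := (S.dualArea v)⁻¹)
    (((memLp_of_continuous ⟨g, hg⟩).integrable one_le_two).const_mul _) (hmeas v)
    (.of_forall fun t => ?_)
  rw [Real.norm_of_nonneg ((hμ t).1 v)]
  exact Prob.le_inv S (hμ t) v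

theorem integrable_pair {μ : ℝ → S.V → ℝ} (hμ : ∀ t, μ t ∈ S.Prob)
    (hmeas : ∀ v, AEStronglyMeasurable (fun t => μ t v) unitVolume) {g : ℝ → S.V → ℝ}
    (hg : ∀ v, Continuous fun t => g t v) : Integrable (fun t => S.pair (g t) (μ t)) unitVolume :=
  integrable_finsetSum _ fun v _ => integrable_pair_mul hμ hmeas (hg v) v

/-- The part of the dual objective that is linear in the potential. -/
def weakDerivFunctional (μ₀ μ₁ : S.V → ℝ) {μ : ℝ → S.V → ℝ} (hμ : ∀ t, μ t ∈ S.Prob)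
    (hmeas : ∀ v, AEStronglyMeasurable (fun t => μ t v) unitVolume) :
    S.smoothPotentials →ₗ[ℝ] ℝ where
  toFun φ := S.pair (φ.1 1) μ₁ - S.pair (φ.1 0) μ₀
    - ∫ t, S.pair (fun v => deriv (fun s => φ.1 s v) t) (μ t) ∂unitVolume
  map_add' φ ψ := by
    simp only [deriv_add_potential]
    change S.pair (φ.1 1 + ψ.1 1) μ₁ - S.pair (φ.1 0 + ψ.1 0) μ₀ - ∫ t, S.pair
      ((fun v => deriv (fun s => φ.1 s v) t) + fun v => deriv (fun s => ψ.1 s v) t) (μ t)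
        ∂unitVolume = _
    simp only [pair_add_left]
    rw [integral_add (integrable_pair hμ hmeas (continuous_deriv_potential φ))
      (integrable_pair hμ hmeas (continuous_deriv_potential ψ))]
    ring
  map_smul' c φ := by
    simp only [deriv_smul_potential]
    change S.pair (c • φ.1 1) μ₁ - S.pair (c • φ.1 0) μ₀ - ∫ t, S.pair
      (c • fun v => deriv (fun s => φ.1 s v) t) (μ t) ∂unitVolume = c * _
    simp only [pair_smul_left]
    rw [integral_const_mul]
    ring

/-- A curve that is continuous in time and lies in `Prob` at almost all times lies in it at all
times. -/
theorem mem_prob_of_ae {μ : ℝ → S.V → ℝ} (hc : ∀ v, ContinuousOn (fun t => μ t v) (Icc 0 1))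
    (h : ∀ᵐ t ∂unitVolume, μ t ∈ S.Prob) : ∀ t ∈ Icc (0 : ℝ) 1, μ t ∈ S.Prob := by
  intro t ht
  refine ⟨fun v => ?_, ?_⟩
  · have := Measure.eqOn_Icc_of_ae_eq volume zero_ne_one (f := fun t => max (μ t v) 0)
      (g := fun t => μ t v) (h.mono fun t ht => max_eq_left (ht.1 v))
      (ContinuousOn.sup (hc v) continuousOn_const) (hc v) ht
    exact max_eq_left_iff.1 this
  · exact Measure.eqOn_Icc_of_ae_eq volume zero_ne_one (f := fun t => ∑ v, S.dualArea v * μ t v)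
      (g := fun _ => 1) (h.mono fun t ht => ht.2)
      (continuousOn_finsetSum _ fun v _ => continuousOn_const.mul (hc v)) continuousOn_const ht

open Classical in
theorem GT_MT_mulVec (x : S.T → EuclideanSpace ℝ (Fin 3)) (v : S.V) :
    ((S.Gᵀ * S.MT) *ᵥ fun p => x p.1 p.2) v
      = ∑ f, S.area f * inner ℝ (S.gradAt (Pi.single v 1) f) (x f) := by
  rw [← S.sum_mul_GT_MT]
  simp [Pi.single_apply]

open Classical in
/-- Existence of an optimal pair. The densities given by strong duality satisfy the continuity
equation weakly, with the velocity that represents the weak time derivative in the Hilbert space of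
weighted fields; hence they have an absolutely continuous version. -/
theorem exists_isAdmissible_action_le {μ₀ μ₁ : S.V → ℝ} (h₀ : μ₀ ∈ S.Prob) (h₁ : μ₁ ∈ S.Prob)
    {W : ℝ} (hW : S.wassersteinSq μ₀ μ₁ ≤ (W : EReal)) :
    ∃ μ w, S.IsAdmissible μ₀ μ₁ μ w ∧ S.action μ w ≤ ENNReal.ofReal W := by
  obtain ⟨μ, hμ, hmeas, hopt⟩ := exists_density_of_wassersteinSq_le h₀ h₁ hW
  obtain ⟨u, hu, hun⟩ := exists_inner_eq_of_sub_half_sq_le (weightedGradL2 hμ hmeas)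
    (weakDerivFunctional μ₀ μ₁ hμ hmeas) (W := W) fun φ => by
      have h1 : Integrable (fun t => S.dirichlet (μ t) (φ.1 t)) unitVolume := by
        have hmem := memLp_rootWeight_smul_gradAt hμ hmeas (continuous_potential φ)
        refine (integrable_finsetSum Finset.univ
          fun f _ => (hmem f).integrable_norm_pow two_ne_zero).congr (.of_forall fun t => ?_)
        refine Finset.sum_congr rfl fun f _ => ?_
        rw [norm_smul, mul_pow, Real.norm_eq_abs, sq_abs, rootWeight_sq (hμ t).1]
      have h2 := hopt φ
      rw [integral_add (integrable_pair hμ hmeas (continuous_deriv_potential φ)) (h1.const_mul _),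
        integral_const_mul] at h2
      rw [norm_weightedGradL2_sq]
      change _ - _ - _ - _ ≤ W
      linarith
  -- the weak time derivative of `|v| μ_v`
  let h : S.V → ℝ → ℝ := fun v t =>
    ∑ f, rootWeight (μ t) f * inner ℝ (u f t) (S.gradAt (Pi.single v 1) f)
  have hint : ∀ v f (η : ℝ → ℝ), Continuous η → Integrable (fun t => η t *
      (rootWeight (μ t) f * inner ℝ (u f t) (S.gradAt (Pi.single v 1) f))) unitVolume := by
    intro v f η hη
    have hm := memLp_rootWeight_smul_gradAt hμ hmeas (φ := fun t => η t • Pi.single v 1)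
      (hη.smul continuous_const) f
    refine (L2.integrable_inner (𝕜 := ℝ) (u f) (hm.toLp _)).congr ?_
    filter_upwards [hm.coeFn_toLp] with t ht
    rw [ht]
    simp only [gradAt_smul, inner_smul_right]
    ring
  have hhint : ∀ v, Integrable (h v) unitVolume := fun v =>
    integrable_finsetSum _ fun f _ => by
      simpa using hint v f (fun _ => 1) continuous_const
  have hbdd : ∀ v, Integrable (fun t => S.dualArea v * μ t v) unitVolume := fun v => by
    simpa using integrable_pair_mul hμ hmeas (continuous_const (y := (1 : ℝ))) v
  have hprim := fun v => ae_eq_primitive_of_weak_deriv (a₀ := S.dualArea v * μ₀ v)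
    (a₁ := S.dualArea v * μ₁ v) (hbdd v) (hhint v) fun η hη => by
      let φ : S.smoothPotentials := ⟨fun t => η t • Pi.single v 1, fun z => by
        simpa using hη.mul contDiff_const⟩
      have h1 := hu φ
      rw [inner_weightedGradL2] at h1
      have h2 : ∀ t, S.pair (fun z => deriv (fun s => φ.1 s z) t) (μ t)
          = deriv η t * (S.dualArea v * μ t v) := fun t => by
        have h3 : ∀ z, deriv (fun s => φ.1 s z) t = deriv η t * (Pi.single v 1 : S.V → ℝ) z :=
          fun z => ((hη.differentiable one_ne_zero t).hasDerivAt.mul_const _).deriv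
        simp only [h3, pair]
        simp [Pi.single_apply]
        ring
      have h4 : ∀ t (ρ : S.V → ℝ), S.pair (φ.1 t) ρ = η t * (S.dualArea v * ρ v) := fun t ρ => by
        change S.pair (η t • Pi.single v 1) ρ = _
        rw [pair_smul_left]
        simp [pair, Pi.single_apply]
      change S.pair (φ.1 1) μ₁ - S.pair (φ.1 0) μ₀ - _ = _ at h1
      simp only [h2, h4] at h1
      rw [h1, ← integral_finsetSum]
      · refine integral_congr_ae (.of_forall fun t => ?_)
        simp only [h, Finset.mul_sum]
        refine Finset.sum_congr rfl fun f _ => ?_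
        change _ * inner ℝ _ (S.gradAt (η t • Pi.single v 1) f) = _
        rw [gradAt_smul, inner_smul_right]
        ring
      · intro f _
        refine (hint v f η hη.continuous).congr (.of_forall fun t => ?_)
        change _ = _ * inner ℝ _ (S.gradAt (η t • Pi.single v 1) f)
        rw [gradAt_smul, inner_smul_right]
        ring
  let ρ : ℝ → S.V → ℝ := fun t v =>
    (S.dualArea v)⁻¹ * (S.dualArea v * μ₀ v + ∫ s in (0 : ℝ)..t, h v s)
  have hρ : ∀ᵐ t ∂unitVolume, ρ t = μ t := by
    filter_upwards [ae_all_iff.2 fun v => (hprim v).1] with t ht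
    funext v
    simp only [ρ, ← ht v]
    exact inv_mul_cancel_left₀ (S.dualArea_pos v).ne' _
  have hhi : ∀ v, IntervalIntegrable (h v) volume 0 1 := fun v =>
    (intervalIntegrable_iff_integrableOn_Icc_of_le zero_le_one).2 (hhint v)
  have hρac : ∀ v, AbsolutelyContinuousOnInterval (fun t => ρ t v) 0 1 := fun v =>
    ((AbsolutelyContinuousOnInterval.const _ 0 1).fun_add
      ((hhi v).absolutelyContinuousOnInterval_intervalIntegral (by simp))).const_mul _
  have hcurve : S.IsCurve μ₀ μ₁ ρ := by
    refine ⟨mem_prob_of_ae (fun v => ?_) (hρ.mono fun t ht => ht ▸ hμ t), ?_, ?_, hρac⟩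
    · have := (hρac v).continuousOn
      rwa [uIcc_of_le zero_le_one] at this
    · funext v
      simp only [ρ, intervalIntegral.integral_same, add_zero]
      exact inv_mul_cancel_left₀ (S.dualArea_pos v).ne' _
    · funext v
      simp only [ρ, (hprim v).2]
      exact inv_mul_cancel_left₀ (S.dualArea_pos v).ne' _
  -- the junk value `0⁻¹ = 0` is the right one: there is no flux where the density vanishes
  let w : ℝ → S.T → EuclideanSpace ℝ (Fin 3) := fun t f =>
    (rootWeight (μ t) f)⁻¹ • (S.tangent f).starProjection (u f t)
  have hw : ∀ t f, (S.area f * S.avg (μ t) f) • w t f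
      = rootWeight (μ t) f • (S.tangent f).starProjection (u f t) := fun t f => by
    simp only [w]
    rw [← rootWeight_sq (hμ t).1, smul_smul]
    rcases eq_or_ne (rootWeight (μ t) f) 0 with h0 | h0
    · simp [h0]
    · rw [sq, mul_assoc, mul_inv_cancel₀ h0, mul_one]
  refine ⟨ρ, w, ⟨hcurve, fun t _ f => Submodule.smul_mem _ _
    ((S.tangent f).starProjection_apply_mem _), fun f => ?_, ?_⟩, ?_⟩
  · exact (aestronglyMeasurable_rootWeight hmeas f).aemeasurable.inv.smul
      ((S.tangent f).starProjection.continuous.comp_aestronglyMeasurable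
        (Lp.aestronglyMeasurable (u f))).aemeasurable
  · have hd : ∀ᵐ t ∂unitVolume, ∀ v,
        HasDerivAt (fun s => ∫ r in (0 : ℝ)..s, h v r) (h v t) t := by
      refine ae_all_iff.2 fun v => (ae_restrict_iff' measurableSet_Icc).2 ?_
      filter_upwards [(hhi v).ae_hasDerivAt_integral] with t ht htI
      rw [uIcc_of_le zero_le_one] at ht
      exact ht htI 0 (by simp)
    filter_upwards [hd, hρ] with t ht hρt v
    have h1 : (fun s => (S.MV *ᵥ ρ s) v)
        = fun s => S.dualArea v * μ₀ v + ∫ r in (0 : ℝ)..s, h v r := by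
      funext s
      rw [MV_mulVec]
      exact mul_inv_cancel_left₀ (S.dualArea_pos v).ne' _
    have h2 : ((S.Gᵀ * S.MT) *ᵥ fun p => S.avg (ρ t) p.1 * w t p.1 p.2) v = h v t := by
      refine (GT_MT_mulVec (fun f => S.avg (ρ t) f • w t f) v).trans ?_
      refine Finset.sum_congr rfl fun f _ => ?_
      rw [← inner_smul_right, smul_smul, hρt, hw, inner_smul_right, real_inner_comm,
        (S.tangent f).inner_starProjection_left_eq_right,
        (S.tangent f).starProjection_eq_self_iff.2 (S.gradAt_spec _ f).1]
    rw [h1, h2]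
    exact (ht v).const_add _
  · have hle : ∀ᵐ t ∂unitVolume,
        ENNReal.ofReal (∑ f, (1 / 2) * ‖w t f‖ ^ 2 * S.area f * S.avg (ρ t) f)
          ≤ ENNReal.ofReal (∑ f, (1 / 2) * ‖u f t‖ ^ 2) := by
      filter_upwards [hρ] with t hρt
      refine ENNReal.ofReal_le_ofReal (Finset.sum_le_sum fun f _ => ?_)
      have h1 : ‖w t f‖ ^ 2 * rootWeight (μ t) f ^ 2 ≤ ‖u f t‖ ^ 2 := by
        have h2 : ‖(S.tangent f).starProjection (u f t)‖ ^ 2 ≤ ‖u f t‖ ^ 2 :=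
          pow_le_pow_left₀ (norm_nonneg _) ((S.tangent f).norm_starProjection_apply_le _) 2
        simp only [w]
        rw [norm_smul, mul_pow, norm_inv, inv_pow, Real.norm_eq_abs, sq_abs]
        rcases eq_or_ne (rootWeight (μ t) f) 0 with h0 | h0
        · rw [h0]
          simp only [ne_eq, OfNat.ofNat_ne_zero, not_false_eq_true, zero_pow, mul_zero]
          positivity
        · rw [mul_right_comm, inv_mul_cancel₀ (pow_ne_zero 2 h0), one_mul]
          exact h2
      rw [hρt, mul_assoc, ← rootWeight_sq (hμ t).1]
      linarith
    refine (lintegral_mono_ae hle).trans ?_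
    have hu2 : ∀ f, Integrable (fun t => (1 / 2) * ‖u f t‖ ^ 2) unitVolume := fun f =>
      ((Lp.memLp (u f)).integrable_norm_pow two_ne_zero).const_mul _
    rw [← ofReal_integral_eq_lintegral_ofReal (integrable_finsetSum _ fun f _ => hu2 f)
      (.of_forall fun t => Finset.sum_nonneg fun f _ => by positivity)]
    refine ENNReal.ofReal_le_ofReal (le_trans (le_of_eq ?_) hun)
    rw [integral_finsetSum _ fun f _ => hu2 f, PiLp.norm_sq_eq_of_L2, Finset.mul_sum]
    refine Finset.sum_congr rfl fun f _ => ?_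
    rw [integral_const_mul, ← real_inner_self_eq_norm_sq, L2.inner_def]
    simp only [real_inner_self_eq_norm_sq]

end TriSurface

end

noncomputable section

namespace TriSurface

variable {S : TriSurface}

theorem exists_isAdmissible_action_eq {μ₀ μ₁ : S.V → ℝ} (h₀ : μ₀ ∈ S.Prob) (h₁ : μ₁ ∈ S.Prob)
    (hW : S.wassersteinSq μ₀ μ₁ ≠ ⊤) :
    ∃ μ w, S.IsAdmissible μ₀ μ₁ μ w ∧ (S.action μ w : EReal) = S.wassersteinSq μ₀ μ₁ := by
  have hbot : S.wassersteinSq μ₀ μ₁ ≠ ⊥ := fun h => by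
    have := S.wassersteinSq_nonneg μ₀ μ₁
    rw [h] at this
    exact absurd this (by simp)
  have hx := EReal.coe_toReal hW hbot
  obtain ⟨μ, w, h, hle⟩ := exists_isAdmissible_action_le h₀ h₁ hx.ge
  refine ⟨μ, w, h, le_antisymm ?_ (S.wassersteinSq_le_action h)⟩
  refine (EReal.coe_ennreal_le_coe_ennreal_iff.2 hle).trans ?_
  rw [EReal.coe_ennreal_ofReal,
    max_eq_left (EReal.toReal_nonneg (S.wassersteinSq_nonneg μ₀ μ₁)), hx]

/-! ### Connected surfaces -/

theorem eq_of_gradAt_eq_zero (hS : S.Connected) {ψ : S.V → ℝ} (h : ∀ f, S.gradAt ψ f = 0)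
    (u v : S.V) : ψ u = ψ v := by
  obtain ⟨p⟩ := hS.preconnected u v
  induction p with
  | nil => rfl
  | cons hadj _ ih =>
    refine Eq.trans ?_ ih
    obtain ⟨-, f, hf, ⟨i, hi⟩, ⟨j, hj⟩⟩ := hadj
    have := (S.gradAt_spec ψ ⟨f, hf⟩).2 i j
    rw [h, inner_zero_left] at this
    rw [← hi, ← hj]
    exact (sub_eq_zero.1 this.symm)

theorem pair_sub_eq_zero_of_connected (hS : S.Connected) {μ₀ μ₁ : S.V → ℝ} (h₀ : μ₀ ∈ S.Prob)
    (h₁ : μ₁ ∈ S.Prob) {ψ : S.V → ℝ} (h : ∀ f, S.gradAt ψ f = 0) : S.pair ψ (μ₁ - μ₀) = 0 := by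
  obtain ⟨v₀⟩ := hS.nonempty
  have h1 : S.pair ψ (μ₁ - μ₀)
      = ψ v₀ * (∑ v, S.dualArea v * μ₁ v - ∑ v, S.dualArea v * μ₀ v) := by
    rw [pair, ← Finset.sum_sub_distrib, Finset.mul_sum]
    refine Finset.sum_congr rfl fun v _ => ?_
    rw [eq_of_gradAt_eq_zero hS h v v₀, Pi.sub_apply]; ring
  rw [h1, h₀.2, h₁.2, sub_self, mul_zero]

/-- On a connected surface, any two densities are joined by a curve of bounded Riemannian speed,
obtained by mixing in the uniform density: its time derivative is of order `t (1 - t)` and its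
density is at least of order `t² (1 - t)²`, so that vanishing boundary densities do no harm. -/
theorem wassersteinSq_lt_top_of_connected (hS : S.Connected) {μ₀ μ₁ : S.V → ℝ} (h₀ : μ₀ ∈ S.Prob)
    (h₁ : μ₁ ∈ S.Prob) : S.wassersteinSq μ₀ μ₁ < ⊤ := by
  set A := ∑ v, S.dualArea v with hA
  have hApos : 0 < A := by
    obtain ⟨v₀⟩ := hS.nonempty
    exact Finset.sum_pos (fun v _ => S.dualArea_pos v) ⟨v₀, Finset.mem_univ v₀⟩
  let m : S.V → ℝ := fun _ => A⁻¹
  have hm : m ∈ S.Prob := by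
    refine ⟨fun _ => inv_nonneg.2 hApos.le, ?_⟩
    rw [← Finset.sum_mul, ← hA, mul_inv_cancel₀ hApos.ne']
  obtain ⟨C₀, hC₀⟩ := S.exists_pair_sub_half_dirichlet_le (δ := m - μ₀)
    fun ψ hψ => pair_sub_eq_zero_of_connected hS h₀ hm hψ
  obtain ⟨C₁, hC₁⟩ := S.exists_pair_sub_half_dirichlet_le (δ := μ₁ - m)
    fun ψ hψ => pair_sub_eq_zero_of_connected hS hm h₁ hψ
  let a : ℝ → ℝ := fun t => (1 - t) ^ 2 * (1 + 2 * t - t ^ 2)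
  let b : ℝ → ℝ := fun t => t ^ 2 * (2 - t ^ 2)
  let c : ℝ → ℝ := fun t => 2 * t ^ 2 * (1 - t) ^ 2
  let ρ : ℝ → S.V → ℝ := fun t v => a t * μ₀ v + b t * μ₁ v + c t * m v
  have ha : ∀ t ∈ Icc (0 : ℝ) 1, 0 ≤ a t := fun t ht =>
    mul_nonneg (sq_nonneg _) (by nlinarith [ht.1, ht.2])
  have hb : ∀ t ∈ Icc (0 : ℝ) 1, 0 ≤ b t := fun t ht =>
    mul_nonneg (sq_nonneg _) (by nlinarith [ht.1, ht.2])
  have hc : ∀ t, 0 ≤ c t := fun t => by positivity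
  have hcurve : S.IsCurve μ₀ μ₁ ρ := by
    refine ⟨fun t ht => ⟨fun v => ?_, ?_⟩, ?_, ?_, fun v => ?_⟩
    · exact add_nonneg (add_nonneg (mul_nonneg (ha t ht) (h₀.1 v)) (mul_nonneg (hb t ht) (h₁.1 v)))
        (mul_nonneg (hc t) (hm.1 v))
    · have : ∑ v, S.dualArea v * ρ t v = a t * ∑ v, S.dualArea v * μ₀ v
          + b t * ∑ v, S.dualArea v * μ₁ v + c t * ∑ v, S.dualArea v * m v := by
        simp only [Finset.mul_sum, ← Finset.sum_add_distrib]
        exact Finset.sum_congr rfl fun v _ => by ring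
      rw [this, h₀.2, h₁.2, hm.2]
      ring
    · funext v; simp [ρ, a, b, c]
    · funext v; simp [ρ, a, b, c]; norm_num
    · refine ContDiffOn.absolutelyContinuousOnInterval (ContDiff.contDiffOn ?_)
      fun_prop
  have hderiv : ∀ t v, deriv (fun s => ρ s v) t
      = (t * (1 - t) * (8 - 4 * t)) * (m - μ₀) v + (t * (1 - t) * (4 + 4 * t)) * (μ₁ - m) v := by
    intro t v
    have e1 : HasDerivAt a (-(t * (1 - t) * (8 - 4 * t))) t := by
      have := (((hasDerivAt_id' t).const_sub 1).pow 2).mul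
        ((((hasDerivAt_id' t).const_mul 2).const_add 1).sub ((hasDerivAt_id' t).pow 2))
      refine this.congr_deriv ?_
      simp
      ring
    have e2 : HasDerivAt b (t * (1 - t) * (4 + 4 * t)) t := by
      have := ((hasDerivAt_id' t).pow 2).mul (((hasDerivAt_id' t).pow 2).const_sub 2)
      refine this.congr_deriv ?_
      simp
      ring
    have e3 : HasDerivAt c (t * (1 - t) * (8 - 4 * t) - t * (1 - t) * (4 + 4 * t)) t := by
      have := (((hasDerivAt_id' t).pow 2).const_mul 2).mul (((hasDerivAt_id' t).const_sub 1).pow 2)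
      refine this.congr_deriv ?_
      simp
      ring
    have := (((e1.mul_const (μ₀ v)).add (e2.mul_const (μ₁ v))).add (e3.mul_const (m v))).deriv
    refine Eq.trans this ?_
    simp only [Pi.sub_apply]
    ring
  refine (S.wassersteinSq_le_lintegral hcurve
    (e := fun _ => ENNReal.ofReal (64 * A * (|C₀| + |C₁|))) ?_).trans_lt ?_
  · filter_upwards [ae_mem_Ioo] with t ht ψ
    refine ENNReal.ofReal_le_ofReal ?_
    have ht0 : 0 < t := ht.1
    have ht1 : 0 < 1 - t := sub_pos.2 ht.2
    have hI := Ioo_subset_Icc_self ht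
    set κ : ℝ := t ^ 2 * (1 - t) ^ 2 * A⁻¹ with hκ
    have hκpos : 0 < κ := by positivity
    have hκle : ∀ v, κ ≤ ((1 / 2 : ℝ) • ρ t) v := fun v => by
      have h1 := mul_nonneg (ha t hI) (h₀.1 v)
      have h2 := mul_nonneg (hb t hI) (h₁.1 v)
      have h3 : c t * m v = 2 * κ := by simp only [c, m, hκ]; ring
      simp only [ρ, Pi.smul_apply, smul_eq_mul]
      linarith
    have h1 := hC₀ _ κ hκpos hκle (t * (1 - t) * (8 - 4 * t)) ψ
    have h2 := hC₁ _ κ hκpos hκle (t * (1 - t) * (4 + 4 * t)) ψ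
    have hs : ∀ x : ℝ, (t * (1 - t) * x) ^ 2 / κ = A * x ^ 2 := fun x => by
      rw [hκ]
      field_simp
    have hbound : ∀ C x : ℝ, 0 ≤ x → x ≤ 8 → C * (A * x ^ 2) ≤ 64 * A * |C| := fun C x h0 h8 => by
      have h3 : A * x ^ 2 ≤ A * 64 := mul_le_mul_of_nonneg_left (by nlinarith) hApos.le
      have h4 : C * (A * x ^ 2) ≤ |C| * (A * x ^ 2) :=
        mul_le_mul_of_nonneg_right (le_abs_self C) (by positivity)
      have h5 := mul_le_mul_of_nonneg_left h3 (abs_nonneg C)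
      linarith
    rw [hs] at h1 h2
    have h3 := hbound C₀ (8 - 4 * t) (by linarith) (by linarith)
    have h4 := hbound C₁ (4 + 4 * t) (by linarith) (by linarith)
    rw [dirichlet_smul_left] at h1 h2
    have h5 : S.pair ψ (fun v => deriv (fun s => ρ s v) t)
        = (t * (1 - t) * (8 - 4 * t)) * S.pair ψ (m - μ₀)
          + (t * (1 - t) * (4 + 4 * t)) * S.pair ψ (μ₁ - m) := by
      rw [← pair_smul_right, ← pair_smul_right, ← pair_add_right]
      congr 1
      funext v
      exact hderiv t v
    rw [h5]
    linarith
  · rw [lintegral_const, ← EReal.coe_ennreal_top, EReal.coe_ennreal_lt_coe_ennreal_iff]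
    simp

/-! ### The Riemannian energy -/

/-- Multiples of a potential with vanishing gradient are subsolutions, so that a finite distance
forces such potentials to have the same mean at both densities. -/
theorem pair_sub_eq_zero_of_ne_top {μ₀ μ₁ : S.V → ℝ} (hW : S.wassersteinSq μ₀ μ₁ ≠ ⊤)
    {ψ : S.V → ℝ} (h : ∀ f, S.gradAt ψ f = 0) : S.pair ψ (μ₁ - μ₀) = 0 := by
  have hle : ∀ c : ℝ, ((c * S.pair ψ (μ₁ - μ₀) : ℝ) : EReal) ≤ S.wassersteinSq μ₀ μ₁ := by
    intro c
    have hsub : S.IsSubsolution fun _ => c • ψ := by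
      refine ⟨fun v => differentiableOn_const _, fun t _ v => ?_⟩
      simp [S.gradAt_smul, h]
    refine le_trans (le_of_eq ?_) (le_iSup₂ (fun _ => c • ψ) hsub)
    rw [EReal.coe_eq_coe_iff, pair, Finset.mul_sum, ← Finset.sum_sub_distrib]
    refine Finset.sum_congr rfl fun v _ => ?_
    simp only [Pi.sub_apply, Pi.smul_apply, smul_eq_mul]
    ring
  by_contra hne
  refine hW ((EReal.eq_top_iff_forall_lt _).2 fun y => ?_)
  refine lt_of_lt_of_le ?_ (hle ((y + 1) / S.pair ψ (μ₁ - μ₀)))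
  rw [div_mul_cancel₀ _ hne, EReal.coe_lt_coe_iff]
  linarith

/-- Mixing an admissible curve with the segment between its ends, which are positive, gives positive
curves whose energy approaches the action: the dual bound of the squared speed is affine in the
density and its variation. -/
theorem exists_positive_curve_energy_le {μ₀ μ₁ : S.V → ℝ} (h₀ : μ₀ ∈ S.Prob) (h₁ : μ₁ ∈ S.Prob)
    (hpos₀ : ∀ v, 0 < μ₀ v) (hpos₁ : ∀ v, 0 < μ₁ v) (hW : S.wassersteinSq μ₀ μ₁ ≠ ⊤)
    {μ : ℝ → S.V → ℝ} {w : ℝ → S.T → EuclideanSpace ℝ (Fin 3)} (h : S.IsAdmissible μ₀ μ₁ μ w) :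
    ∃ C : ℝ, ∀ ε ∈ Ioo (0 : ℝ) 1, ∃ ρ, S.IsCurve μ₀ μ₁ ρ ∧
      (∀ t ∈ Icc (0 : ℝ) 1, ∀ v, 0 < ρ t v) ∧
      S.energy ρ ≤ S.action μ w + ENNReal.ofReal (ε * C) := by
  obtain ⟨C, hC⟩ := S.exists_pair_sub_half_dirichlet_le (δ := μ₁ - μ₀)
    fun ψ hψ => pair_sub_eq_zero_of_ne_top hW hψ
  have hne : (Finset.univ : Finset S.V).Nonempty := by
    rw [Finset.nonempty_iff_ne_empty]
    intro h
    have := h₀.2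
    rw [h, Finset.sum_empty] at this
    exact zero_ne_one this
  obtain ⟨v₀, -, hv₀⟩ := Finset.exists_min_image Finset.univ (fun v => min (μ₀ v) (μ₁ v)) hne
  set c := min (μ₀ v₀) (μ₁ v₀) with hc
  have hcpos : 0 < c := lt_min (hpos₀ v₀) (hpos₁ v₀)
  have hc₀ : ∀ v, c ≤ μ₀ v := fun v => (hv₀ v (Finset.mem_univ v)).trans (min_le_left _ _)
  have hc₁ : ∀ v, c ≤ μ₁ v := fun v => (hv₀ v (Finset.mem_univ v)).trans (min_le_right _ _)
  let σ : ℝ → S.V → ℝ := fun t => (1 - t) • μ₀ + t • μ₁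
  have hσ : ∀ t ∈ Icc (0 : ℝ) 1, ∀ v, c ≤ σ t v := fun t ht v => by
    simp only [σ, Pi.add_apply, Pi.smul_apply, smul_eq_mul]
    nlinarith [mul_le_mul_of_nonneg_left (hc₀ v) (sub_nonneg.2 ht.2),
      mul_le_mul_of_nonneg_left (hc₁ v) ht.1]
  have hσd : ∀ t v, HasDerivAt (fun s => σ s v) ((μ₁ - μ₀) v) t := fun t v => by
    have := (((hasDerivAt_id' t).const_sub 1).mul_const (μ₀ v)).add
      ((hasDerivAt_id' t).mul_const (μ₁ v))
    refine this.congr_deriv ?_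
    simp only [Pi.sub_apply]
    ring
  refine ⟨C * (1 / c), fun ε hε => ?_⟩
  have hε1 : 0 < 1 - ε := sub_pos.2 hε.2
  let ρ : ℝ → S.V → ℝ := fun t => (1 - ε) • μ t + ε • σ t
  have hρpos : ∀ t ∈ Icc (0 : ℝ) 1, ∀ v, 0 < ρ t v := fun t ht v =>
    add_pos_of_nonneg_of_pos (mul_nonneg hε1.le ((h.isCurve.mem_prob t ht).1 v))
      (mul_pos hε.1 (hcpos.trans_le (hσ t ht v)))
  refine ⟨ρ, ⟨fun t ht => ?_, ?_, ?_, fun v => ?_⟩, hρpos, ?_⟩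
  · exact S.convex_prob (h.isCurve.mem_prob t ht)
      (S.convex_prob h₀ h₁ (sub_nonneg.2 ht.2) ht.1 (by ring)) hε1.le hε.1.le (by ring)
  · funext v
    simp only [ρ, σ, h.isCurve.start, Pi.add_apply, Pi.smul_apply, smul_eq_mul]; ring
  · funext v
    simp only [ρ, σ, h.isCurve.finish, Pi.add_apply, Pi.smul_apply, smul_eq_mul]; ring
  · refine ((h.isCurve.absCont v).const_mul (1 - ε)).fun_add
      (AbsolutelyContinuousOnInterval.const_mul ε
        (ContDiffOn.absolutelyContinuousOnInterval (ContDiff.contDiffOn ?_)))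
    simp only [σ, Pi.add_apply, Pi.smul_apply, smul_eq_mul]
    fun_prop
  · have hle : ∀ᵐ t ∂unitVolume, S.tangentNormSq (ρ t) (fun v => deriv (fun s => ρ s v) t)
        ≤ ENNReal.ofReal (∑ f, (1 / 2) * ‖w t f‖ ^ 2 * S.area f * S.avg (μ t) f)
          + ENNReal.ofReal (ε * (C * (1 / c))) := by
      filter_upwards [h.ae_pair_sub_le, h.isCurve.ae_hasDerivAt, ae_restrict_mem measurableSet_Icc]
        with t ht hd htI
      have hd' : (fun v => deriv (fun s => ρ s v) t)
          = (1 - ε) • (fun v => deriv (fun s => μ s v) t) + ε • (μ₁ - μ₀) := by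
        funext v
        exact (((hd v).const_mul (1 - ε)).add ((hσd t v).const_mul ε)).deriv
      set B := ∑ f, (1 / 2) * ‖w t f‖ ^ 2 * S.area f * S.avg (μ t) f with hB
      have hBnn : 0 ≤ B := Finset.sum_nonneg fun f _ => mul_nonneg
        (mul_nonneg (by positivity) (S.area_pos f).le)
        (S.avg_nonneg (h.isCurve.mem_prob t htI).1 f)
      refine (S.tangentNormSq_le (fun v => (hρpos t htI v).le) (A := (1 - ε) * B
        + ε * (C * (1 / c))) fun ψ => ?_).trans ?_
      · have e1 := mul_le_mul_of_nonneg_left (ht ψ) hε1.le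
        have e2 := hC (σ t) c hcpos (hσ t htI) 1 ψ
        rw [one_mul, one_pow] at e2
        have e3 := mul_le_mul_of_nonneg_left e2 hε.1.le
        rw [hd']
        simp only [ρ, pair_add_right, pair_smul_right, dirichlet_add_left, dirichlet_smul_left]
        linarith
      · refine (ENNReal.ofReal_le_ofReal (add_le_add_left ?_ _)).trans ENNReal.ofReal_add_le
        nlinarith [hε.1]
    refine (lintegral_mono_ae hle).trans ?_
    rw [lintegral_add_right _ measurable_const, lintegral_const, measure_univ, mul_one]
    exact le_rfl

end TriSurface

end

theorem proposition1 (S : TriSurface) (μ₀ μ₁ : S.V → ℝ)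
    (h₀ : μ₀ ∈ S.Prob) (h₁ : μ₁ ∈ S.Prob) :
    S.wassersteinSq μ₀ μ₁ =
        (⨅ (μ : ℝ → S.V → ℝ) (w : ℝ → S.T → EuclideanSpace ℝ (Fin 3))
          (_ : S.IsAdmissible μ₀ μ₁ μ w), (S.action μ w : EReal)) ∧
    ((∃ μ w, S.IsAdmissible μ₀ μ₁ μ w) →
        ∃ μ w, S.IsAdmissible μ₀ μ₁ μ w ∧ (S.action μ w : EReal) = S.wassersteinSq μ₀ μ₁) ∧
    (S.Connected →
        (∃ μ w, S.IsAdmissible μ₀ μ₁ μ w) ∧ S.wassersteinSq μ₀ μ₁ < ⊤) ∧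
    ((∀ v, 0 < μ₀ v) → (∀ v, 0 < μ₁ v) →
        S.wassersteinSq μ₀ μ₁ =
          ⨅ (μ : ℝ → S.V → ℝ) (_ : S.IsCurve μ₀ μ₁ μ)
            (_ : ∀ t ∈ Set.Icc (0 : ℝ) 1, ∀ v, 0 < μ t v), (S.energy μ : EReal)) := by
  refine ⟨?_, ?_, fun hS => ?_, fun hpos₀ hpos₁ => ?_⟩
  · refine le_antisymm (le_iInf₂ fun μ w => le_iInf fun h => S.wassersteinSq_le_action h) ?_
    by_cases hW : S.wassersteinSq μ₀ μ₁ = ⊤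
    · exact hW ▸ le_top
    · obtain ⟨μ, w, h, heq⟩ := TriSurface.exists_isAdmissible_action_eq h₀ h₁ hW
      exact heq ▸ iInf₂_le_of_le μ w (iInf_le _ h)
  · rintro ⟨μ, w, h⟩
    by_cases hW : S.wassersteinSq μ₀ μ₁ = ⊤
    · exact ⟨μ, w, h, le_antisymm (hW ▸ le_top) (S.wassersteinSq_le_action h)⟩
    · exact TriSurface.exists_isAdmissible_action_eq h₀ h₁ hW
  · have hW := TriSurface.wassersteinSq_lt_top_of_connected hS h₀ h₁
    obtain ⟨μ, w, h, -⟩ := TriSurface.exists_isAdmissible_action_eq h₀ h₁ hW.ne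
    exact ⟨⟨μ, w, h⟩, hW⟩
  · refine le_antisymm (le_iInf₂ fun μ h => le_iInf fun _ => S.wassersteinSq_le_energy h) ?_
    by_cases hW : S.wassersteinSq μ₀ μ₁ = ⊤
    · exact hW ▸ le_top
    obtain ⟨μ, w, h, heq⟩ := TriSurface.exists_isAdmissible_action_eq h₀ h₁ hW
    obtain ⟨C, hC⟩ := TriSurface.exists_positive_curve_energy_le h₀ h₁ hpos₀ hpos₁ hW h
    rw [← heq]
    refine EReal.le_of_forall_lt_iff_le.1 fun z hz => ?_
    have hfin : S.action μ w ≠ ⊤ := fun h => by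
      rw [h, EReal.coe_ennreal_top] at hz
      exact not_top_lt hz
    obtain ⟨x, hx0, hx⟩ : ∃ x : ℝ, 0 ≤ x ∧ ENNReal.ofReal x = S.action μ w :=
      ⟨_, ENNReal.toReal_nonneg, ENNReal.ofReal_toReal hfin⟩
    rw [← hx, EReal.coe_ennreal_ofReal, max_eq_left hx0, EReal.coe_lt_coe_iff] at hz
    -- the mixing parameter is small enough for the error `ε C` to fit below `z`
    have hpos : 0 < (z - x) / (|C| + 1) := div_pos (sub_pos.2 hz) (by positivity)
    obtain ⟨ρ, hρ, hρpos, hle⟩ := hC (min (1 / 2) ((z - x) / (|C| + 1)))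
      ⟨lt_min (by norm_num) hpos, (min_le_left _ _).trans_lt (by norm_num)⟩
    have hεC : min (1 / 2) ((z - x) / (|C| + 1)) * C ≤ z - x := by
      calc min (1 / 2) ((z - x) / (|C| + 1)) * C
          ≤ min (1 / 2) ((z - x) / (|C| + 1)) * (|C| + 1) :=
            mul_le_mul_of_nonneg_left ((le_abs_self C).trans (by linarith))
              (le_min (by norm_num) hpos.le)
        _ ≤ (z - x) / (|C| + 1) * (|C| + 1) :=
            mul_le_mul_of_nonneg_right (min_le_right _ _) (by positivity)
        _ = z - x := div_mul_cancel₀ _ (by positivity)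
    refine (iInf₂_le_of_le ρ hρ (iInf_le _ hρpos)).trans ?_
    have hz' : S.energy ρ ≤ ENNReal.ofReal z := by
      refine hle.trans ?_
      rw [← hx]
      refine (add_le_add_right (ENNReal.ofReal_le_ofReal hεC) _).trans ?_
      rw [← ENNReal.ofReal_add hx0 (sub_nonneg.2 hz.le), add_sub_cancel]
    refine (EReal.coe_ennreal_le_coe_ennreal_iff.2 hz').trans ?_
    rw [EReal.coe_ennreal_ofReal, max_eq_left (hx0.trans hz.le)]
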